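/- **Setting.** Consider a finite Markov decision process with state space $S$, action space $A$, transition probabilities $P_{\rm env}(s'|s,a)$, rewards $r(s,a)$, $r_{\max}=\max|r(s,a)|$, and a fixed policy $\pi$. Let $P(s'|s)=\sum_a P_{\rm env}(s'|s,a)\pi(a|s)$ and $R=(r_s)_s$ with $r_s=\sum_a\pi(a|s)r(s,a)$. Assume $P$ is irreducible and aperiodic, with stationary distribution $\mu$, and let $C>1$, $b\in[0,1)$ be such that $\|P^k(\cdot|s)-\mu\|_1\le Cb^k$ for all $k\ge0$, $s\in S$. Let $\Phi\in\mathbb R^{S\times d}$ have linearly independent columns and rows $\phi(s)^\top$ with $\|\phi(s)\|\le1$, let $D=\mathrm{diag}(\mu)$, and $$\eta=\min_{\|x\|=1}\ \tfrac12\sum_{s,s'}\mu(s)P(s'|s)\big((\Phi x)(s)-(\Phi x)(s')\big)^2+(\mu^\top\Phi x)^2,\qquad \eta'=\lambda_{\min}(\Phi^\top D\Phi).$$ Let $w^*=\Phi^\top\mu$ and let $\theta^*$ be the solution of $\Phi^\top D(R+P\Phi\theta^*-\Phi\theta^*)-\mu^\top(R+\Phi\theta^*)\,w^*=0$. The single-chain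 algorithm runs along a trajectory $s_0,s_1,\dots$ of the Markov chain $P$ (arbitrary law of $s_0$): $$w_{t+1}=\mathrm{Proj}_{R_w}\{w_t+\beta_t(\phi(s_t)-w_t)\},$$ $$\theta_{t+1}=\mathrm{Proj}_{R_\theta}\big\{\theta_t+\alpha_t\big[(r_{s_t}+\phi(s_{t+1})^\top\theta_t-\phi(s_t)^\top\theta_t)\phi(s_t)-(r_{s_t}+\phi(s_t)^\top\theta_t)w_t\big]\big\},$$ where $\mathrm{Proj}_\rho$ is the Euclidean projection onto the closed ball of radius $\rho$ about $0$, $R_w\ge1$, $R_\theta>0$, $\|\theta^*\|\le R_\theta$, $\|w_0\|\le1$, $\|\theta_0\|\le R_\theta$, and $$\alpha_t=\frac{a}{(t+c_0)^\xi},\qquad\beta_t=\rho_0\alpha_t,\qquad a>0,\ \rho_0\in(0,1],\ \xi\in(0,1].$$ For $\lambda>0$ and $T\in\mathbb N$ put $c_{1,\lambda}=\eta-\tfrac12\lambda^2(r_{\max}+2R_\theta)$, $c_{2,\lambda}=(r_{\max}+2R_\theta)/\lambda^2$, $L_1=\max\{1,\frac{\log C+1}{\log(1/b)}\}$ (which is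 $1$ if $b=0$), $$G_1(T)=\big(4(28+8\rho_0)L_1(\log(T+c_0)-\log a+1)+4\big)(r_{\max}+3R_\theta)^2,$$ $$G_2(T)=64L_1\big(\log(T+c_0)-\log(\rho_0a)+1\big)+12,\qquad \Gamma_0=\frac{4a^2}{1-ac_{1,\lambda}},$$ $$\Gamma_1=\begin{cases}\frac{2^{ac_{1,\lambda}}ac_{2,\lambda}}{2\rho_0a-ac_{1,\lambda}}\Big(4(\tau+c_0)^{2\rho_0a}+\frac{4\rho_0^2a^2}{1-2\rho_0a}G_2(T)\Big),&\rho_0a<\tfrac12,\\[1mm] \frac{4ac_{2,\lambda}}{1-ac_{1,\lambda}}\Big(4(\tau+c_0)^{2\rho_0a}+4\rho_0^2a^2\log(T+c_0)\,G_2(T)\Big),&\rho_0a=\tfrac12,\\[1mm] \frac{4ac_{2,\lambda}}{1-ac_{1,\lambda}}\Big(4(\tau+c_0)^{2\rho_0a}+\frac{4e\rho_0^2a^2}{2\rho_0a-1}G_2(T)\Big),&\rho_0a>\tfrac12,\end{cases}$$ and $\Delta_T=(T+c_0)^{1-\xi}-(\tau+c_0)^{1-\xi}$. Here $\tau$ is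 any integer with $\tau_{\rm mix}\le\tau\le T$ (for instance $\tau=\tau_{\rm mix}$), where $\tau_{\rm mix}=\tau_{\rm mix}(\beta_T)$ is the least $k$ with $\max_s\|P^k(\cdot|s)-\mu\|_1\le\beta_T$. **Theorem.** There is an absolute constant $M>0$, and for all $a,\rho_0,\xi,C,b$ as above there is a threshold $\bar c>0$ depending only on $a,\rho_0,\xi,C,b$, such that for every such problem, every $\lambda>0$, every $c_0\ge\bar c$ and all $\tau_{\rm mix}\le\tau\le T$: 1. If $\xi\in(0,1)$, $\lambda^2<\frac{2\eta}{r_{\max}+2R_\theta}$ and $c_0\ge\max\Big\{\big(\frac{\xi}{ac_{1,\lambda}}\big)^{\frac1{1-\xi}},\big(\frac{\xi}{\rho_0a}\big)^{\frac1{1-\xi}}\Big\}$, then $$\mathbb E\|\theta_T-\theta^*\|^2\le 4R_\theta^2\exp\Big(-\frac{ac_{1,\lambda}}{1-\xi}\Delta_T\Big)+\frac{a\big(G_1(T)+\rho_0c_{2,\lambda}G_2(T)\big)}{c_{1,\lambda}(T+c_0)^\xi}+\frac{4ac_{2,\lambda}}{1-\xi}\exp\Big(\frac{ac_{1,\lambda}}{c_0^\xi}\Big)\Delta_T\exp\Big(-\frac{a}{1-\xi}\min\{c_{1,\lambda},2\rho_0\}\Delta_T\Big).$$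 2. If $\xi=1$, $a\eta<1$, $\lambda^2\le\frac{2\eta}{r_{\max}+2R_\theta}$ and $\lambda^2>\frac{2\eta-4\rho_0}{r_{\max}+2R_\theta}$, then $$\mathbb E\|\theta_T-\theta^*\|^2\le4R_\theta^2\Big(\frac{\tau+c_0}{T+c_0}\Big)^{ac_{1,\lambda}}+\frac{\Gamma_1+\Gamma_0G_1(T)}{(T+c_0)^{ac_{1,\lambda}}}.$$ 3. (Condition-number dependence.) If $\lambda^2=\frac{\eta}{r_{\max}+2R_\theta}$ and $K\ge1$ satisfies $r_{\max}\le K$, $R_\theta\le K/\sqrt{\eta'}$ and $a\le K/\eta$, then the coefficient of $(T+c_0)^{-\xi}$ in part 1 satisfies $$\frac{a\big(G_1(T)+\rho_0c_{2,\lambda}G_2(T)\big)}{c_{1,\lambda}}\le\frac{M K^3L_1\big(\log(T+c_0)-\log(\rho_0a)+1\big)}{\eta'\,\eta^{3}},$$ and if moreover $\eta\le K\eta'$, it is at most $M K^4L_1\big(\log(T+c_0)-\log(\rho_0a)+1\big)\,\eta^{-4}$. -/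

import Mathlib

open MeasureTheory Matrix

noncomputable section

namespace SingleChainTD

/-- A finite Markov decision process with a fixed (stochastic) policy and a feature matrix.
`env s a s'` is the probability of moving from `s` to `s'` under action `a`, `policy s a` is the
probability of taking action `a` in state `s`, `reward s a` is the reward, and the rows of `Φ`
are the feature vectors of the states. -/
structure Model (S A : Type*) [Fintype S] [Fintype A] (d : ℕ) where
  env : S → A → S → ℝ
  env_nonneg : ∀ s a s', 0 ≤ env s a s'
  env_sum : ∀ s a, ∑ s', env s a s' = 1
  policy : S → A → ℝ
  policy_nonneg : ∀ s a, 0 ≤ policy s a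
  policy_sum : ∀ s, ∑ a, policy s a = 1
  reward : S → A → ℝ
  Φ : Matrix S (Fin d) ℝ

/-- Aperiodicity of a finite transition matrix: for every state, the greatest common divisor of
the lengths of the possible returns to that state is `1`. -/
def IsAperiodic {S : Type*} [Fintype S] [DecidableEq S] (P : Matrix S S ℝ) : Prop :=
  ∀ (i : S) (k : ℕ), (∀ n : ℕ, 1 ≤ n → 0 < (P ^ n) i i → k ∣ n) → k = 1

/-- `μ` is a stationary probability distribution of the transition matrix `P`. -/
structure IsStationaryDist {S : Type*} [Fintype S] (P : Matrix S S ℝ) (μ : S → ℝ) : Prop where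
  nonneg : ∀ s, 0 ≤ μ s
  sum_eq_one : ∑ s, μ s = 1
  invariant : μ ᵥ* P = μ

/-- `‖p_k(· | s) - μ‖₁`, the `ℓ¹` distance to `μ` of the law after `k` steps started at `s`. -/
def mixDist {S : Type*} [Fintype S] [DecidableEq S] (P : Matrix S S ℝ) (μ : S → ℝ)
    (k : ℕ) (s : S) : ℝ :=
  ∑ s', |(P ^ k) s s' - μ s'|

/-- The mixing time at accuracy `ε`: the least `k` such that the law after `k` steps is within
`ε` of `μ` in `ℓ¹`, for every starting state. -/
def mixingTime {S : Type*} [Fintype S] [DecidableEq S] (P : Matrix S S ℝ) (μ : S → ℝ)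
    (ε : ℝ) : ℕ :=
  sInf {k : ℕ | ∀ s, mixDist P μ k s ≤ ε}

/-- The `S`-valued process `s` is a Markov chain with transition matrix `P` under `ℙ`
(the initial law is arbitrary). -/
structure IsMarkovChain {S Ω : Type*} [MeasurableSpace Ω] (P : Matrix S S ℝ)
    (ℙ : Measure Ω) (s : ℕ → Ω → S) : Prop where
  measurable : ∀ (t : ℕ) (x : S), MeasurableSet {ω | s t ω = x}
  markov : ∀ (t : ℕ) (x : ℕ → S),
    ℙ.real {ω | ∀ i ≤ t + 1, s i ω = x i} =
      ℙ.real {ω | ∀ i ≤ t, s i ω = x i} * P (x t) (x (t + 1))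

/-- The squared Dirichlet seminorm `½ ∑ μ(s) P(s' | s) (f(s) - f(s'))²`. -/
def dirSq {S : Type*} [Fintype S] (P : Matrix S S ℝ) (μ : S → ℝ) (f : S → ℝ) : ℝ :=
  (1 / 2) * ∑ s, ∑ s', μ s * P s s' * (f s - f s') ^ 2

/-- The Euclidean projection onto the closed ball of radius `ρ` (for `0 ≤ ρ`). -/
def projBall {E : Type*} [NormedAddCommGroup E] [NormedSpace ℝ E] (ρ : ℝ) (x : E) : E :=
  open Classical in if ‖x‖ ≤ ρ then x else (ρ / ‖x‖) • x

namespace Model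

variable {S A : Type*} [Fintype S] [Fintype A] {d : ℕ}

/-- The transition matrix induced by the policy. -/
def P (m : Model S A d) : Matrix S S ℝ := fun s s' => ∑ a, m.env s a s' * m.policy s a

/-- The vector of expected rewards, `r_s = ∑ₐ π(a | s) r(s, a)`. -/
def R (m : Model S A d) : S → ℝ := fun s => ∑ a, m.policy s a * m.reward s a

/-- `r_max = max |r(s, a)|`. -/
def rMax (m : Model S A d) : ℝ := ⨆ p : S × A, |m.reward p.1 p.2|

/-- The feature vector `φ(s)`, the `s`-th row of `Φ`, in Euclidean space. -/
def φ (m : Model S A d) (s : S) : EuclideanSpace ℝ (Fin d) := WithLp.toLp 2 (m.Φ s)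

/-- The function `Φ θ` on states, `(Φ θ)(s) = φ(s)ᵀ θ`. -/
def lin (m : Model S A d) (θ : EuclideanSpace ℝ (Fin d)) : S → ℝ := m.Φ *ᵥ θ.ofLp

/-- Normalized features, `‖φ(s)‖ ≤ 1`, and linearly independent columns of `Φ`. -/
structure GoodFeatures (m : Model S A d) : Prop where
  norm_le_one : ∀ s, ‖m.φ s‖ ≤ 1
  linearIndependent : LinearIndependent ℝ m.Φ.col

/-- The condition number `η = min_{‖x‖ = 1} ‖Φ x‖²_Dir + (μᵀ Φ x)²`. -/
def eta (m : Model S A d) (μ : S → ℝ) : ℝ :=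
  ⨅ x : Metric.sphere (0 : EuclideanSpace ℝ (Fin d)) 1,
    (dirSq m.P μ (m.lin x) + (μ ⬝ᵥ m.lin x) ^ 2)

/-- `η' = λ_min(Φᵀ D Φ) = min_{‖x‖ = 1} ‖Φ x‖²_D`. -/
def eta' (m : Model S A d) (μ : S → ℝ) : ℝ :=
  ⨅ x : Metric.sphere (0 : EuclideanSpace ℝ (Fin d)) 1, ∑ s, μ s * m.lin x s ^ 2

/-- `w* = Φᵀ μ`. -/
def wStar (m : Model S A d) (μ : S → ℝ) : EuclideanSpace ℝ (Fin d) :=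
  WithLp.toLp 2 (m.Φᵀ *ᵥ μ)

/-- The stationary mean `Φᵀ D (R + P Φ θ - Φ θ) - μᵀ (R + Φ θ) w` of the `θ`-update. -/
def gBar [DecidableEq S] (m : Model S A d) (μ : S → ℝ) (w θ : EuclideanSpace ℝ (Fin d)) :
    EuclideanSpace ℝ (Fin d) :=
  WithLp.toLp 2 (m.Φᵀ *ᵥ (Matrix.diagonal μ *ᵥ (m.R + m.P *ᵥ m.lin θ - m.lin θ)))
    - (μ ⬝ᵥ (m.R + m.lin θ)) • w

/-- The defining equation of `θ*`: the mean `θ`-update vanishes at `(w*, θ*)`. -/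
def IsFixedPoint [DecidableEq S] (m : Model S A d) (μ : S → ℝ)
    (θ : EuclideanSpace ℝ (Fin d)) : Prop :=
  m.gBar μ (m.wStar μ) θ = 0

/-- `f(s, w) = φ(s) - w`. -/
def fUpd (m : Model S A d) (s : S) (w : EuclideanSpace ℝ (Fin d)) :
    EuclideanSpace ℝ (Fin d) :=
  m.φ s - w

/-- `g(s, s', w, θ) = (r_s + φ(s')ᵀθ - φ(s)ᵀθ) φ(s) - (r_s + φ(s)ᵀθ) w`. -/
def gUpd (m : Model S A d) (s s' : S) (w θ : EuclideanSpace ℝ (Fin d)) :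
    EuclideanSpace ℝ (Fin d) :=
  (m.R s + m.lin θ s' - m.lin θ s) • m.φ s - (m.R s + m.lin θ s) • w

/-- One step of the single-chain algorithm from `p = (w, θ)`, with step size `α` for `θ` and `β`
for `w`, projection radii `Rw`, `Rθ`, current state `s` and next state `s'`. -/
def next (m : Model S A d) (α β Rw Rθ : ℝ) (s s' : S)
    (p : EuclideanSpace ℝ (Fin d) × EuclideanSpace ℝ (Fin d)) :
    EuclideanSpace ℝ (Fin d) × EuclideanSpace ℝ (Fin d) :=
  (projBall Rw (p.1 + β • m.fUpd s p.1), projBall Rθ (p.2 + α • m.gUpd s s' p.1 p.2))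

/-- The iterates `(w_t, θ_t)` of the single-chain algorithm along the trajectory `s`, with step
sizes `α`, `β`, projection radii `Rw`, `Rθ` and initial point `(w₀, θ₀)`. Under Markov sampling
the state `s_t'` that follows `s_t` is the next state `s_{t+1}` of the chain. -/
def iterates (m : Model S A d) (α β : ℕ → ℝ) (Rw Rθ : ℝ)
    (w₀ θ₀ : EuclideanSpace ℝ (Fin d)) (s : ℕ → S) :
    ℕ → EuclideanSpace ℝ (Fin d) × EuclideanSpace ℝ (Fin d)
  | 0 => (w₀, θ₀)
  | t + 1 => m.next (α t) (β t) Rw Rθ (s t) (s (t + 1)) (iterates m α β Rw Rθ w₀ θ₀ s t)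

end Model

/-- The step size `α_t = a / (t + c₀)^ξ`. -/
def step (a c₀ ξ : ℝ) (t : ℕ) : ℝ := a / ((t : ℝ) + c₀) ^ ξ

/-- `L₁ = max {1, (log C + 1) / log (1/b)}` for the mixing bound `C bᵏ`
(for `b = 0` this is `1`). -/
def L₁ (C b : ℝ) : ℝ := max 1 ((Real.log C + 1) / Real.log (1 / b))

/-- `c_{1,λ} = η - λ² (r_max + 2 R_θ) / 2`. -/
def c₁ (η rmax Rθ lam : ℝ) : ℝ := η - lam ^ 2 * (rmax + 2 * Rθ) / 2

/-- `c_{2,λ} = (r_max + 2 R_θ) / λ²`. -/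
def c₂ (rmax Rθ lam : ℝ) : ℝ := (rmax + 2 * Rθ) / lam ^ 2

/-- `G₁(T) = (4 ρ₁ L₁ (log (T + c₀) - log a + 1) + 4) (r_max + 3 R_θ)²`, `ρ₁ = 28 + 8 ρ₀`. -/
def G₁ (a c₀ ρ₀ C b rmax Rθ : ℝ) (T : ℕ) : ℝ :=
  (4 * (28 + 8 * ρ₀) * L₁ C b * (Real.log ((T : ℝ) + c₀) - Real.log a + 1) + 4)
    * (rmax + 3 * Rθ) ^ 2

/-- `G₂(T) = 64 L₁ (log (T + c₀) - log (ρ₀ a) + 1) + 12`. -/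
def G₂ (a c₀ ρ₀ C b : ℝ) (T : ℕ) : ℝ :=
  64 * L₁ C b * (Real.log ((T : ℝ) + c₀) - Real.log (ρ₀ * a) + 1) + 12

/-- `Γ₀ = 4 a² / (1 - a c_{1,λ})`. -/
def Γ₀ (a c1 : ℝ) : ℝ := 4 * a ^ 2 / (1 - a * c1)

open Classical in
/-- `Γ₁`, in the three regimes `ρ₀ a < 1/2`, `ρ₀ a = 1/2` and `ρ₀ a > 1/2`. Here `c1`, `c2` are
`c_{1,λ}`, `c_{2,λ}`, `G2` is `G₂(T)`, and `τ` is the mixing time. -/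
def Γ₁ (a c₀ ρ₀ c1 c2 G2 : ℝ) (τ T : ℕ) : ℝ :=
  if ρ₀ * a < 1 / 2 then
    (2 : ℝ) ^ (a * c1) * a * c2 / (2 * ρ₀ * a - a * c1) *
      (4 * ((τ : ℝ) + c₀) ^ (2 * ρ₀ * a) + 4 * ρ₀ ^ 2 * a ^ 2 / (1 - 2 * ρ₀ * a) * G2)
  else if ρ₀ * a = 1 / 2 then
    4 * a * c2 / (1 - a * c1) *
      (4 * ((τ : ℝ) + c₀) ^ (2 * ρ₀ * a)
        + 4 * ρ₀ ^ 2 * a ^ 2 * Real.log ((T : ℝ) + c₀) * G2)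
  else
    4 * a * c2 / (1 - a * c1) *
      (4 * ((τ : ℝ) + c₀) ^ (2 * ρ₀ * a)
        + 4 * Real.exp 1 * ρ₀ ^ 2 * a ^ 2 / (2 * ρ₀ * a - 1) * G2)

/-- `Δ_T = (T + c₀)^{1-ξ} - (τ + c₀)^{1-ξ}`. -/
def Δ (c₀ ξ : ℝ) (τ T : ℕ) : ℝ :=
  ((T : ℝ) + c₀) ^ (1 - ξ) - ((τ : ℝ) + c₀) ^ (1 - ξ)

end SingleChainTD

end

open SingleChainTD

/-!
Both iterates are Lyapunov-controlled: the mean squared errors of the mean estimate `w` and of `θ`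
obey a pair of linear recursions, the first of which drives the second. The drift of `w` is exactly
`-2β`. That of `θ` is at least as negative as `-2αη`, because the quadratic form of the averaged
update is the Dirichlet form of the chain plus the squared stationary mean; Young's inequality with
weight `λ` pays for replacing `w*` by `w` and turns `η` into `c₁`, at the cost `c₂` on the error of
`w`.

Markovian noise is removed by freezing the iterates one mixing time in the past. Conditionally on
that past the chain is within `β_T` of stationarity, so the noise averages out up to `β_T`, while
the displacement of the iterates over the lag is of the order of the lag times the step size. Both
errors are of second order in the step size, up to the logarithm hidden in the mixing time.

For `ξ < 1` the recursions are solved by comparison with exponentials of sums of step sizes, for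
`ξ = 1` by comparison with powers of `t + c₀`.
-/

namespace SingleChainTD

section Projection

variable {E : Type*} [NormedAddCommGroup E]

lemma projBall_of_norm_le [NormedSpace ℝ E] {ρ : ℝ} {x : E} (h : ‖x‖ ≤ ρ) :
    projBall ρ x = x :=
  if_pos h

lemma norm_projBall_le [NormedSpace ℝ E] {ρ : ℝ} (hρ : 0 ≤ ρ) (x : E) : ‖projBall ρ x‖ ≤ ρ := by
  unfold projBall
  split_ifs with h
  · exact h
  · have hx : 0 < ‖x‖ := hρ.trans_lt (not_le.mp h)
    rw [norm_smul, Real.norm_of_nonneg (by positivity), div_mul_cancel₀ _ hx.ne']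

lemma norm_projBall_sub_le [InnerProductSpace ℝ E] {ρ : ℝ} (hρ : 0 ≤ ρ) (x : E) {y : E}
    (hy : ‖y‖ ≤ ρ) : ‖projBall ρ x - y‖ ≤ ‖x - y‖ := by
  unfold projBall
  split_ifs with h
  · exact le_rfl
  have hx : 0 < ‖x‖ := hρ.trans_lt (not_le.mp h)
  set c := ρ / ‖x‖ with hc
  have hρc : ρ = c * ‖x‖ := by rw [hc, div_mul_cancel₀ _ hx.ne']
  have hc1 : c ≤ 1 := (div_le_one hx).2 (not_le.mp h).le
  have hinner : inner ℝ x y ≤ ‖x‖ * (c * ‖x‖) := by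
    rw [← hρc]
    exact (real_inner_le_norm x y).trans (by gcongr)
  rw [← sq_le_sq₀ (norm_nonneg _) (norm_nonneg _), norm_sub_sq_real, norm_sub_sq_real,
    norm_smul, real_inner_smul_left, Real.norm_of_nonneg (by positivity)]
  nlinarith [mul_nonneg (sub_nonneg.2 hc1) (sub_nonneg.2 hinner), sq_nonneg ((1 - c) * ‖x‖)]

end Projection

section InnerProduct

variable {E : Type*} [NormedAddCommGroup E] [InnerProductSpace ℝ E]

lemma norm_add_smul_sq (z g : E) (r : ℝ) :
    ‖z + r • g‖ ^ 2 = ‖z‖ ^ 2 + 2 * r * inner ℝ g z + r ^ 2 * ‖g‖ ^ 2 := by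
  rw [norm_add_sq_real, real_inner_smul_right, norm_smul, mul_pow, Real.norm_eq_abs, sq_abs,
    real_inner_comm]
  ring

lemma inner_le_inner_add (p q z y : E) :
    inner ℝ p z ≤ inner ℝ q y + ‖q‖ * ‖z - y‖ + ‖p - q‖ * ‖z‖ := by
  have hsplit : inner ℝ p z = inner ℝ q y + inner ℝ q (z - y) + inner ℝ (p - q) z := by
    rw [inner_sub_right, inner_sub_left]
    ring
  linarith [real_inner_le_norm q (z - y), real_inner_le_norm (p - q) z]

end InnerProduct

section TransMean

variable {S E : Type*} [Fintype S] [AddCommGroup E] [Module ℝ E] {P : Matrix S S ℝ} {μ : S → ℝ}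

/-- The mean of `v s s'` when `s` has law `μ` and the transition `s → s'` follows `P`. -/
def transMean (P : Matrix S S ℝ) (μ : S → ℝ) (v : S → S → E) : E :=
  ∑ s, ∑ s', (μ s * P s s') • v s s'

lemma transMean_sub (v w : S → S → E) :
    transMean P μ (fun s s' => v s s' - w s s') = transMean P μ v - transMean P μ w := by
  simp only [transMean, smul_sub, Finset.sum_sub_distrib]

lemma transMean_mul_left (r : ℝ) (f : S → S → ℝ) :
    transMean P μ (fun s s' => r * f s s') = r * transMean P μ f := by
  simp only [transMean, smul_eq_mul, Finset.mul_sum, mul_left_comm r]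

lemma transMean_eq_sum [DecidableEq S] (hP : P ∈ rowStochastic ℝ S) (v : S → E) :
    transMean P μ (fun s _ => v s) = ∑ s, μ s • v s := by
  simp only [transMean, ← Finset.sum_smul, ← Finset.mul_sum, sum_row_of_mem_rowStochastic hP,
    mul_one]

lemma IsStationaryDist.transMean_snd (hμ : IsStationaryDist P μ) (v : S → E) :
    transMean P μ (fun _ s' => v s') = ∑ s, μ s • v s := by
  rw [transMean, Finset.sum_comm]
  refine Finset.sum_congr rfl fun s' _ => ?_
  rw [← Finset.sum_smul]
  congr 1
  exact congrFun hμ.invariant s'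

lemma IsStationaryDist.transMean_const [DecidableEq S] (hμ : IsStationaryDist P μ)
    (hP : P ∈ rowStochastic ℝ S) (v : E) : transMean P μ (fun _ _ => v) = v := by
  rw [transMean_eq_sum hP, ← Finset.sum_smul, hμ.sum_eq_one, one_smul]

end TransMean

section NormTransMean

variable {S E : Type*} [Fintype S] [NormedAddCommGroup E] {P : Matrix S S ℝ} {μ : S → ℝ}

lemma inner_transMean [InnerProductSpace ℝ E] (v : S → S → E) (x : E) :
    inner ℝ (transMean P μ v) x = transMean P μ fun s s' => inner ℝ (v s s') x := by
  simp only [transMean, sum_inner, real_inner_smul_left, smul_eq_mul]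

lemma IsStationaryDist.norm_transMean_le [DecidableEq S] [NormedSpace ℝ E]
    (hμ : IsStationaryDist P μ) (hP : P ∈ rowStochastic ℝ S) {v : S → S → E} {B : ℝ}
    (hv : ∀ s s', ‖v s s'‖ ≤ B) :
    ‖transMean P μ v‖ ≤ B := by
  have hweight : ∀ s s', 0 ≤ μ s * P s s' := fun s s' =>
    mul_nonneg (hμ.nonneg s) (nonneg_of_mem_rowStochastic hP)
  calc ‖transMean P μ v‖ ≤ ∑ s, ∑ s', ‖(μ s * P s s') • v s s'‖ :=
        (norm_sum_le _ _).trans (Finset.sum_le_sum fun s _ => norm_sum_le _ _)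
    _ ≤ transMean P μ fun _ _ => B := by
        refine Finset.sum_le_sum fun s _ => Finset.sum_le_sum fun s' _ => ?_
        rw [norm_smul, Real.norm_of_nonneg (hweight s s')]
        exact mul_le_mul_of_nonneg_left (hv s s') (hweight s s')
    _ = B := hμ.transMean_const hP B

end NormTransMean

section FinitePaths

variable {S Ω : Type*} {s : ℕ → Ω → S}

/-- Extension of a path of length `n + 1` by repeating its last state. -/
def extendPath {n : ℕ} (x : Fin (n + 1) → S) : ℕ → S :=
  fun i => x ⟨min i n, Nat.lt_succ_of_le (min_le_right i n)⟩

lemma forall_eq_extendPath_iff {n : ℕ} (ω : Ω) (x : Fin (n + 1) → S) :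
    (∀ i ≤ n, s i ω = extendPath x i) ↔ x = fun i : Fin (n + 1) => s i ω := by
  constructor
  · intro h
    ext i
    have hi : (i : ℕ) ≤ n := Nat.lt_succ_iff.1 i.2
    simpa [extendPath, min_eq_left hi] using (h i hi).symm
  · rintro rfl i hi
    simp [extendPath, min_eq_left hi]

variable [Fintype S]

open Classical in
lemma eq_sum_indicator_extendPath {n : ℕ} {f : (ℕ → S) → ℝ} (hf : DependsOn f (Set.Iic n))
    (ω : Ω) : f (fun t => s t ω) = ∑ x : Fin (n + 1) → S,
      {ω | ∀ i ≤ n, s i ω = extendPath x i}.indicator (fun _ => f (extendPath x)) ω := by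
  simp only [Set.indicator_apply, Set.mem_ofPred_eq, forall_eq_extendPath_iff]
  rw [Finset.sum_ite_eq']
  simpa using hf ((forall_eq_extendPath_iff ω _).2 rfl)

variable [MeasurableSpace Ω] {ν : Measure Ω} [IsFiniteMeasure ν]
  (hs : ∀ (t : ℕ) (x : S), MeasurableSet {ω | s t ω = x})

include hs

omit [Fintype S] in
lemma measurableSet_path (n : ℕ) (x : ℕ → S) : MeasurableSet {ω | ∀ i ≤ n, s i ω = x i} := by
  have hinter : {ω | ∀ i ≤ n, s i ω = x i} = ⋂ i ∈ Finset.Iic n, {ω | s i ω = x i} := by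
    ext ω; simp
  rw [hinter]
  exact Finset.measurableSet_biInter _ fun i _ => hs i (x i)

omit [Fintype S] in
lemma integrable_of_dependsOn [Finite S] {n : ℕ} {f : (ℕ → S) → ℝ}
    (hf : DependsOn f (Set.Iic n)) : Integrable (fun ω => f (fun t => s t ω)) ν := by
  cases nonempty_fintype S
  simp_rw [eq_sum_indicator_extendPath (s := s) hf]
  exact integrable_finsetSum _ fun x _ => (integrable_const _).indicator (measurableSet_path hs n _)

lemma integral_eq_sum_extendPath {n : ℕ} {f : (ℕ → S) → ℝ} (hf : DependsOn f (Set.Iic n)) :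
    ∫ ω, f (fun t => s t ω) ∂ν = ∑ x : Fin (n + 1) → S,
      ν.real {ω | ∀ i ≤ n, s i ω = extendPath x i} * f (extendPath x) := by
  simp_rw [eq_sum_indicator_extendPath (s := s) hf]
  rw [integral_finsetSum _ fun x _ => (integrable_const _).indicator (measurableSet_path hs n _)]
  refine Finset.sum_congr rfl fun x _ => ?_
  rw [integral_indicator_const _ (measurableSet_path hs n _), smul_eq_mul]

end FinitePaths

namespace IsMarkovChain

variable {S Ω : Type*} [MeasurableSpace Ω] {P : Matrix S S ℝ} {ℙ : Measure Ω} {s : ℕ → Ω → S}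

lemma measureReal_path_inter_next (hs : IsMarkovChain P ℙ s) (n : ℕ) (x : ℕ → S) (y : S) :
    ℙ.real ({ω | ∀ i ≤ n, s i ω = x i} ∩ {ω | s (n + 1) ω = y})
      = ℙ.real {ω | ∀ i ≤ n, s i ω = x i} * P (x n) y := by
  have hagree : ∀ i ≤ n, Function.update x (n + 1) y i = x i := fun i hi =>
    Function.update_of_ne (by omega) _ _
  have hpast : {ω | ∀ i ≤ n, s i ω = Function.update x (n + 1) y i}
      = {ω | ∀ i ≤ n, s i ω = x i} := by
    ext ω
    exact forall₂_congr fun i hi => by rw [hagree i hi]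
  have hnext : {ω | ∀ i ≤ n + 1, s i ω = Function.update x (n + 1) y i}
      = {ω | ∀ i ≤ n, s i ω = x i} ∩ {ω | s (n + 1) ω = y} := by
    rw [← hpast]
    ext ω
    simp [Nat.le_succ_iff, or_imp, forall_and]
  have hmarkov := hs.markov n (Function.update x (n + 1) y)
  rwa [hpast, hnext, hagree n le_rfl, Function.update_self] at hmarkov

variable [IsFiniteMeasure ℙ] (hs : IsMarkovChain P ℙ s)

include hs

lemma setIntegral_next [Finite S] {n : ℕ} {f : (ℕ → S) → ℝ} (hf : DependsOn f (Set.Iic n)) (y : S) :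
    ∫ ω in {ω | s (n + 1) ω = y}, f (fun t => s t ω) ∂ℙ
      = ∫ ω, P (s n ω) y * f (fun t => s t ω) ∂ℙ := by
  cases nonempty_fintype S
  have hPf : DependsOn (fun x : ℕ → S => P (x n) y * f x) (Set.Iic n) := fun x x' h => by
    simp only [h n Set.self_mem_Iic, hf h]
  rw [integral_eq_sum_extendPath hs.measurable hf, integral_eq_sum_extendPath hs.measurable hPf]
  refine Finset.sum_congr rfl fun x _ => ?_
  rw [measureReal_restrict_apply (measurableSet_path hs.measurable n _),
    hs.measureReal_path_inter_next, mul_assoc]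

variable [Fintype S]

lemma integral_next {n : ℕ} {F : (ℕ → S) → S → ℝ}
    (hF : ∀ y, DependsOn (fun x => F x y) (Set.Iic n)) :
    ∫ ω, F (fun t => s t ω) (s (n + 1) ω) ∂ℙ
      = ∫ ω, ∑ y, P (s n ω) y * F (fun t => s t ω) y ∂ℙ := by
  classical
  have hPF : ∀ y, DependsOn (fun x : ℕ → S => P (x n) y * F x y) (Set.Iic n) :=
    fun y x x' h => by simp only [h n Set.self_mem_Iic, hF y h]
  have hsplit : ∀ ω, F (fun t => s t ω) (s (n + 1) ω)
      = ∑ y, {ω | s (n + 1) ω = y}.indicator (fun ω => F (fun t => s t ω) y) ω := fun ω => by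
    simp [Set.indicator_apply]
  simp_rw [hsplit]
  rw [integral_finsetSum _ fun y _ =>
      (integrable_of_dependsOn hs.measurable (hF y)).indicator (hs.measurable _ y),
    integral_finsetSum _ fun y _ => integrable_of_dependsOn hs.measurable (hPF y)]
  refine Finset.sum_congr rfl fun y _ => ?_
  rw [integral_indicator (hs.measurable _ y), hs.setIntegral_next (hF y)]

variable [DecidableEq S]

lemma integral_add (k : ℕ) {n : ℕ} {F : (ℕ → S) → S → ℝ}
    (hF : ∀ y, DependsOn (fun x => F x y) (Set.Iic n)) :
    ∫ ω, F (fun t => s t ω) (s (n + k) ω) ∂ℙ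
      = ∫ ω, ∑ y, (P ^ k) (s n ω) y * F (fun t => s t ω) y ∂ℙ := by
  induction k generalizing F with
  | zero => simp [Matrix.one_apply]
  | succ k ih =>
    have hPF : ∀ z, DependsOn (fun x => ∑ y, P z y * F x y) (Set.Iic n) := fun z x x' h => by
      simp only [hF _ h]
    rw [← add_assoc,
      hs.integral_next fun y => (hF y).mono (Set.Iic_subset_Iic.2 (Nat.le_add_right n k)), ih hPF]
    refine integral_congr_ae (ae_of_all _ fun ω => ?_)
    simp only [pow_succ, Matrix.mul_apply, Finset.mul_sum, Finset.sum_mul, mul_assoc]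
    exact Finset.sum_comm

lemma integral_transition (n k : ℕ) {F : (ℕ → S) → S → S → ℝ}
    (hF : ∀ y z, DependsOn (fun x => F x y z) (Set.Iic n)) :
    ∫ ω, F (fun t => s t ω) (s (n + k) ω) (s (n + k + 1) ω) ∂ℙ
      = ∫ ω, ∑ y, (P ^ k) (s n ω) y * ∑ z, P y z * F (fun t => s t ω) y z ∂ℙ := by
  have hnext : ∀ z, DependsOn (fun x : ℕ → S => F x (x (n + k)) z) (Set.Iic (n + k)) :=
    fun z x x' h => by
      simp only [h (n + k) Set.self_mem_Iic,
        ((hF _ z).mono (Set.Iic_subset_Iic.2 (Nat.le_add_right n k))) h]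
  rw [hs.integral_next hnext,
    hs.integral_add k (F := fun x y => ∑ z, P y z * F x y z) fun y x x' h => by
      simp only [hF y _ h]]

end IsMarkovChain

section MixDist

variable {S : Type*} [Fintype S] [DecidableEq S] {P : Matrix S S ℝ} {μ : S → ℝ}

lemma sum_pow_mul_le_of_sum_mul_eq_zero {h : S → ℝ} {B : ℝ} (hμh : ∑ y, μ y * h y = 0)
    (hB : ∀ y, |h y| ≤ B) (k : ℕ) (s : S) : ∑ y, (P ^ k) s y * h y ≤ B * mixDist P μ k s := by
  calc ∑ y, (P ^ k) s y * h y = ∑ y, ((P ^ k) s y - μ y) * h y := by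
        simp only [sub_mul, Finset.sum_sub_distrib, hμh, sub_zero]
    _ ≤ ∑ y, |(P ^ k) s y - μ y| * B := Finset.sum_le_sum fun y _ =>
        (le_abs_self _).trans (by rw [abs_mul]; gcongr; exact hB y)
    _ = B * mixDist P μ k s := by rw [← Finset.sum_mul, mul_comm, mixDist]

lemma abs_sum_row_mul_le (hP : P ∈ rowStochastic ℝ S) {f : S → ℝ} {B : ℝ} (hB : ∀ z, |f z| ≤ B)
    (y : S) : |∑ z, P y z * f z| ≤ B := by
  calc |∑ z, P y z * f z| ≤ ∑ z, P y z * B := by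
        refine (Finset.abs_sum_le_sum_abs _ _).trans (Finset.sum_le_sum fun z _ => ?_)
        rw [abs_mul, abs_of_nonneg (nonneg_of_mem_rowStochastic hP)]
        exact mul_le_mul_of_nonneg_left (hB z) (nonneg_of_mem_rowStochastic hP)
    _ = B := by rw [← Finset.sum_mul, sum_row_of_mem_rowStochastic hP, one_mul]

/-- The lag `k` decorrelates the transition from the past, so that a functional with vanishing
stationary mean for every frozen past has an expectation of the order of the mixing error. -/
lemma IsMarkovChain.integral_transition_le {Ω : Type*} [MeasurableSpace Ω] {ℙ : Measure Ω}
    [IsProbabilityMeasure ℙ] {s : ℕ → Ω → S} (hs : IsMarkovChain P ℙ s)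
    (hP : P ∈ rowStochastic ℝ S) {n k : ℕ} {F : (ℕ → S) → S → S → ℝ} {B ε : ℝ}
    (hF : ∀ y z, DependsOn (fun x => F x y z) (Set.Iic n))
    (hmean : ∀ x, transMean P μ (F x) = 0) (hB : ∀ x y z, |F x y z| ≤ B)
    (hmix : ∀ y, mixDist P μ k y ≤ ε) :
    ∫ ω, F (fun t => s t ω) (s (n + k) ω) (s (n + k + 1) ω) ∂ℙ ≤ B * ε := by
  rw [hs.integral_transition n k hF]
  refine (integral_mono (integrable_of_dependsOn hs.measurable
      (f := fun x => ∑ y, (P ^ k) (x n) y * ∑ z, P y z * F x y z) (n := n) fun x x' h => by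
        simp only [h n Set.self_mem_Iic, hF _ _ h])
    (integrable_const (B * ε)) fun ω => ?_).trans (by simp)
  set x : ℕ → S := fun t => s t ω
  have hB0 : 0 ≤ B := (abs_nonneg _).trans (hB x (x n) (x n))
  have hmean' : ∑ y, μ y * ∑ z, P y z * F x y z = 0 := by
    simpa only [transMean, smul_eq_mul, mul_assoc, Finset.mul_sum] using hmean x
  exact (sum_pow_mul_le_of_sum_mul_eq_zero hmean' (fun y => abs_sum_row_mul_le hP (hB x y) y) k
    (x n)).trans (mul_le_mul_of_nonneg_left (hmix _) hB0)

end MixDist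

section MixingTime

variable {S : Type*} [Fintype S] [DecidableEq S] {P : Matrix S S ℝ} {μ : S → ℝ} {C b ε : ℝ}

lemma one_le_L₁ (C b : ℝ) : 1 ≤ L₁ C b := le_max_left _ _

lemma exists_geometric_le (hC : 1 ≤ C) (hb0 : 0 ≤ b) (hb1 : b < 1) (hε : 0 < ε)
    (hε1 : ε ≤ Real.exp (-1)) :
    ∃ k : ℕ, C * b ^ k ≤ ε ∧ (k : ℝ) ≤ L₁ C b * (1 - Real.log ε) := by
  have hlogε : Real.log ε ≤ -1 := by simpa using Real.log_le_log hε hε1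
  have hL := one_le_L₁ C b
  rcases hb0.eq_or_lt with rfl | hb
  · exact ⟨1, by simpa using hε.le, by push_cast; nlinarith⟩
  have hlogb : 0 < Real.log (1 / b) := Real.log_pos (by rwa [lt_div_iff₀ hb, one_mul])
  have hlogC : 0 ≤ Real.log C := Real.log_nonneg hC
  set q := (Real.log C - Real.log ε) / Real.log (1 / b) with hq
  have hq0 : 0 ≤ q := div_nonneg (by linarith) hlogb.le
  refine ⟨⌈q⌉₊, ?_, ?_⟩
  · have hk : Real.log C - Real.log ε ≤ ⌈q⌉₊ * Real.log (1 / b) := by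
      rw [← div_le_iff₀ hlogb]
      exact Nat.le_ceil _
    rw [← Real.log_le_log_iff (by positivity) hε, Real.log_mul (by positivity) (by positivity),
      Real.log_pow]
    rw [one_div, Real.log_inv] at hk
    linarith
  · have hqL : q ≤ L₁ C b * (-Real.log ε) := by
      calc q ≤ (Real.log C + 1) / Real.log (1 / b) * (-Real.log ε) := by
            rw [hq, div_mul_eq_mul_div]
            gcongr
            nlinarith
        _ ≤ L₁ C b * (-Real.log ε) := by
            gcongr
            · linarith
            · exact le_max_right _ _
    linarith [(Nat.ceil_lt_add_one hq0).le]

variable (hmix : ∀ (k : ℕ) (s : S), mixDist P μ k s ≤ C * b ^ k) (hC : 1 ≤ C) (hb0 : 0 ≤ b)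
  (hb1 : b < 1) (hε : 0 < ε) (hε1 : ε ≤ Real.exp (-1))

include hmix hC hb0 hb1 hε hε1

lemma mixDist_mixingTime_le (s : S) : mixDist P μ (mixingTime P μ ε) s ≤ ε := by
  obtain ⟨k, hk, -⟩ := exists_geometric_le hC hb0 hb1 hε hε1
  exact Nat.sInf_mem (s := {k : ℕ | ∀ s, mixDist P μ k s ≤ ε}) ⟨k, fun s => (hmix k s).trans hk⟩ s

lemma mixingTime_le : (mixingTime P μ ε : ℝ) ≤ L₁ C b * (1 - Real.log ε) := by
  obtain ⟨k, hk, hkL⟩ := exists_geometric_le hC hb0 hb1 hε hε1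
  have hmem : mixingTime P μ ε ≤ k := Nat.sInf_le fun s => (hmix k s).trans hk
  exact (Nat.cast_le.2 hmem).trans hkL

lemma mixingTime_anti {ε' : ℝ} (h : ε ≤ ε') : mixingTime P μ ε' ≤ mixingTime P μ ε :=
  Nat.sInf_le fun s => (mixDist_mixingTime_le hmix hC hb0 hb1 hε hε1 s).trans h

end MixingTime

section Dirichlet

variable {S : Type*} [Fintype S] {P : Matrix S S ℝ} {μ : S → ℝ}

lemma dirSq_eq_transMean (f : S → ℝ) :
    dirSq P μ f = 1 / 2 * transMean P μ fun s s' => (f s - f s') ^ 2 := rfl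

lemma dirSq_smul (r : ℝ) (f : S → ℝ) : dirSq P μ (r • f) = r ^ 2 * dirSq P μ f := by
  simp only [dirSq_eq_transMean, Pi.smul_apply, smul_eq_mul, ← mul_sub, mul_pow,
    transMean_mul_left]
  ring

namespace IsStationaryDist

variable [DecidableEq S] (hμ : IsStationaryDist P μ) (hP : P ∈ rowStochastic ℝ S)

include hμ hP

lemma norm_sum_smul_le {E : Type*} [NormedAddCommGroup E] [NormedSpace ℝ E] {v : S → E} {B : ℝ}
    (hv : ∀ s, ‖v s‖ ≤ B) : ‖∑ s, μ s • v s‖ ≤ B := by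
  rw [← transMean_eq_sum hP]
  exact hμ.norm_transMean_le hP fun s _ => hv s

lemma abs_dotProduct_le {f : S → ℝ} {B : ℝ} (hf : ∀ s, |f s| ≤ B) : |μ ⬝ᵥ f| ≤ B :=
  hμ.norm_sum_smul_le hP (v := f) hf

lemma dirSq_nonneg (f : S → ℝ) : 0 ≤ dirSq P μ f :=
  mul_nonneg (by norm_num) <| Finset.sum_nonneg fun s _ => Finset.sum_nonneg fun _ _ =>
    mul_nonneg (mul_nonneg (hμ.nonneg s) (nonneg_of_mem_rowStochastic hP)) (sq_nonneg _)

lemma dirSq_le_two {f : S → ℝ} (hf : ∀ s, |f s| ≤ 1) : dirSq P μ f ≤ 2 := by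
  have hbound : ‖transMean P μ fun s s' => (f s - f s') ^ 2‖ ≤ 4 :=
    hμ.norm_transMean_le hP fun s s' => by
      rw [norm_pow, Real.norm_eq_abs]
      have := abs_sub (f s) (f s')
      nlinarith [hf s, hf s', abs_nonneg (f s - f s')]
  rw [dirSq_eq_transMean]
  linarith [Real.le_norm_self (transMean P μ fun s s' => (f s - f s') ^ 2)]

lemma transMean_sub_mul (f : S → ℝ) :
    transMean P μ (fun s s' => (f s' - f s) * f s) = -dirSq P μ f := by
  have hsquare : (fun s s' => (f s - f s') ^ 2)
      = fun s s' => f s' ^ 2 - f s ^ 2 - 2 * ((f s' - f s) * f s) := by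
    ext s s'; ring
  rw [dirSq_eq_transMean, hsquare, transMean_sub, transMean_sub,
    hμ.transMean_snd fun s => f s ^ 2, transMean_eq_sum hP fun s => f s ^ 2, transMean_mul_left]
  ring

end IsStationaryDist

end Dirichlet

lemma iInf_le_of_forall_le {ι : Sort*} {f : ι → ℝ} {B : ℝ} (hB : 0 ≤ B) (hf : ∀ i, 0 ≤ f i)
    (hfB : ∀ i, f i ≤ B) : ⨅ i, f i ≤ B := by
  rcases isEmpty_or_nonempty ι with _ | ⟨⟨i⟩⟩
  · rwa [Real.iInf_of_isEmpty]
  · exact ciInf_le_of_le ⟨0, by rintro _ ⟨i, rfl⟩; exact hf i⟩ i (hfB i)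

namespace Model

variable {S A : Type*} [Fintype S] [Fintype A] {d : ℕ} (m : Model S A d)

lemma P_mem_rowStochastic [DecidableEq S] : m.P ∈ rowStochastic ℝ S := by
  refine mem_rowStochastic_iff_sum.2 ⟨fun s s' => Finset.sum_nonneg fun a _ =>
    mul_nonneg (m.env_nonneg s a s') (m.policy_nonneg s a), fun s => ?_⟩
  unfold P
  rw [Finset.sum_comm]
  simp_rw [← Finset.sum_mul, m.env_sum, one_mul, m.policy_sum]

lemma rMax_nonneg : 0 ≤ m.rMax := Real.iSup_nonneg fun _ => abs_nonneg _

lemma abs_reward_le (s : S) (a : A) : |m.reward s a| ≤ m.rMax :=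
  le_ciSup (f := fun p : S × A => |m.reward p.1 p.2|) (Set.finite_range _).bddAbove (s, a)

lemma abs_R_le (s : S) : |m.R s| ≤ m.rMax := by
  calc |m.R s| ≤ ∑ a, |m.policy s a * m.reward s a| := Finset.abs_sum_le_sum_abs _ _
    _ ≤ ∑ a, m.policy s a * m.rMax := by
        refine Finset.sum_le_sum fun a _ => ?_
        rw [abs_mul, abs_of_nonneg (m.policy_nonneg s a)]
        exact mul_le_mul_of_nonneg_left (m.abs_reward_le s a) (m.policy_nonneg s a)
    _ = m.rMax := by rw [← Finset.sum_mul, m.policy_sum, one_mul]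

lemma inner_φ (s : S) (x : EuclideanSpace ℝ (Fin d)) : inner ℝ (m.φ s) x = m.lin x s := by
  simp [φ, lin, PiLp.inner_apply, Matrix.mulVec, dotProduct, mul_comm]

lemma lin_sub (x y : EuclideanSpace ℝ (Fin d)) (s : S) :
    m.lin (x - y) s = m.lin x s - m.lin y s := by
  simp_rw [← inner_φ, inner_sub_right]

lemma lin_smul (c : ℝ) (x : EuclideanSpace ℝ (Fin d)) : m.lin (c • x) = c • m.lin x := by
  simp only [lin, WithLp.ofLp_smul, Matrix.mulVec_smul]

lemma wStar_eq_sum (μ : S → ℝ) : m.wStar μ = ∑ s, μ s • m.φ s := by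
  ext i
  simp [wStar, φ, Matrix.mulVec, dotProduct, mul_comm]

lemma inner_wStar (μ : S → ℝ) (x : EuclideanSpace ℝ (Fin d)) :
    inner ℝ (m.wStar μ) x = μ ⬝ᵥ m.lin x := by
  simp only [wStar_eq_sum, sum_inner, real_inner_smul_left, inner_φ, dotProduct]

lemma inner_gUpd (s s' : S) (w θ x : EuclideanSpace ℝ (Fin d)) :
    inner ℝ (m.gUpd s s' w θ) x
      = (m.R s + m.lin θ s' - m.lin θ s) * m.lin x s - (m.R s + m.lin θ s) * inner ℝ w x := by
  rw [gUpd, inner_sub_left, real_inner_smul_left, real_inner_smul_left, inner_φ]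

lemma gBar_eq_transMean [DecidableEq S] (μ : S → ℝ) (w θ : EuclideanSpace ℝ (Fin d)) :
    m.gBar μ w θ = transMean m.P μ fun s s' => m.gUpd s s' w θ := by
  have hmean : transMean m.P μ (fun s s' => m.gUpd s s' w θ)
      = ∑ s, (μ s * (m.R s + (m.P *ᵥ m.lin θ) s - m.lin θ s)) • m.φ s
        - (μ ⬝ᵥ (m.R + m.lin θ)) • w := by
    have hrow : ∀ s, ∑ s', m.P s s' = 1 := sum_row_of_mem_rowStochastic m.P_mem_rowStochastic
    simp only [gUpd, transMean_sub, transMean_eq_sum m.P_mem_rowStochastic]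
    congr 1
    · refine Finset.sum_congr rfl fun s _ => ?_
      simp only [smul_smul, ← Finset.sum_smul, Matrix.mulVec, dotProduct]
      congr 1
      calc ∑ s', μ s * m.P s s' * (m.R s + m.lin θ s' - m.lin θ s)
          = μ s * (∑ s', m.P s s') * (m.R s - m.lin θ s)
            + μ s * ∑ s', m.P s s' * m.lin θ s' := by
            rw [Finset.mul_sum, Finset.mul_sum, Finset.sum_mul, ← Finset.sum_add_distrib]
            exact Finset.sum_congr rfl fun s' _ => by ring
        _ = _ := by rw [hrow]; ring
    · simp only [smul_smul, ← Finset.sum_smul, dotProduct, Pi.add_apply]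
  rw [hmean, gBar]
  congr 1
  ext i
  simp [φ, Matrix.mulVec, dotProduct, Matrix.diagonal_apply, mul_comm]

variable {m} {μ : S → ℝ} {w w' θ θ' θstar : EuclideanSpace ℝ (Fin d)} {r : ℝ}

section Stationary

variable (hμ : IsStationaryDist m.P μ)

include hμ

lemma inner_gBar_sub_gBar [DecidableEq S] (w θ θ' : EuclideanSpace ℝ (Fin d)) :
    inner ℝ (m.gBar μ w θ - m.gBar μ w θ') (θ - θ')
      = -dirSq m.P μ (m.lin (θ - θ')) - (μ ⬝ᵥ m.lin (θ - θ')) * inner ℝ w (θ - θ') := by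
  set x := θ - θ' with hx
  have hdiff : (fun s s' => inner ℝ (m.gUpd s s' w θ - m.gUpd s s' w θ') x)
      = fun s s' => (m.lin x s' - m.lin x s) * m.lin x s - inner ℝ w x * m.lin x s := by
    ext s s'
    simp only [inner_sub_left, inner_gUpd]
    rw [show m.lin x s = m.lin θ s - m.lin θ' s by rw [hx, lin_sub],
      show m.lin x s' = m.lin θ s' - m.lin θ' s' by rw [hx, lin_sub]]
    ring
  rw [gBar_eq_transMean, gBar_eq_transMean, ← transMean_sub, inner_transMean, hdiff, transMean_sub,
    hμ.transMean_sub_mul m.P_mem_rowStochastic, transMean_mul_left,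
    transMean_eq_sum m.P_mem_rowStochastic, mul_comm]
  rfl

lemma dirSq_add_sq_nonneg (x : EuclideanSpace ℝ (Fin d)) :
    0 ≤ dirSq m.P μ (m.lin x) + (μ ⬝ᵥ m.lin x) ^ 2 := by
  classical
  exact add_nonneg (hμ.dirSq_nonneg m.P_mem_rowStochastic _) (sq_nonneg _)

lemma eta_mul_norm_sq_le (x : EuclideanSpace ℝ (Fin d)) :
    m.eta μ * ‖x‖ ^ 2 ≤ dirSq m.P μ (m.lin x) + (μ ⬝ᵥ m.lin x) ^ 2 := by
  rcases eq_or_ne x 0 with rfl | hx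
  · simpa using dirSq_add_sq_nonneg hμ 0
  have : 0 < ‖x‖ := norm_pos_iff.2 hx
  have hunit : ‖‖x‖⁻¹ • x‖ = 1 := norm_smul_inv_norm (𝕜 := ℝ) hx
  have hle : m.eta μ ≤ dirSq m.P μ (m.lin (‖x‖⁻¹ • x)) + (μ ⬝ᵥ m.lin (‖x‖⁻¹ • x)) ^ 2 :=
    ciInf_le (f := fun y : Metric.sphere (0 : EuclideanSpace ℝ (Fin d)) 1 =>
      dirSq m.P μ (m.lin y) + (μ ⬝ᵥ m.lin y) ^ 2)
      ⟨0, by rintro _ ⟨y, rfl⟩; exact dirSq_add_sq_nonneg hμ _⟩ ⟨_, by simpa using hunit⟩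
  rw [lin_smul, dirSq_smul, dotProduct_smul, smul_eq_mul, mul_pow, ← mul_add] at hle
  calc m.eta μ * ‖x‖ ^ 2
      ≤ ‖x‖⁻¹ ^ 2 * (dirSq m.P μ (m.lin x) + (μ ⬝ᵥ m.lin x) ^ 2) * ‖x‖ ^ 2 := by gcongr
    _ = _ := by field_simp

end Stationary

section NormalizedFeatures

variable (hφ : ∀ s, ‖m.φ s‖ ≤ 1)

include hφ

lemma abs_lin_le (x : EuclideanSpace ℝ (Fin d)) (s : S) : |m.lin x s| ≤ ‖x‖ := by
  rw [← inner_φ]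
  calc |inner ℝ (m.φ s) x| ≤ ‖m.φ s‖ * ‖x‖ := abs_real_inner_le_norm _ _
    _ ≤ 1 * ‖x‖ := by gcongr; exact hφ s
    _ = ‖x‖ := one_mul _

lemma abs_R_add_lin_le (hθ : ‖θ‖ ≤ r) (s : S) : |m.R s + m.lin θ s| ≤ m.rMax + r :=
  (abs_add_le _ _).trans (add_le_add (m.abs_R_le s) ((abs_lin_le hφ θ s).trans hθ))

lemma norm_lin_sub_smul_φ_le (s s' : S) (x : EuclideanSpace ℝ (Fin d)) :
    ‖(m.lin x s' - m.lin x s) • m.φ s‖ ≤ 2 * ‖x‖ := by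
  rw [norm_smul, Real.norm_eq_abs, ← mul_one (2 * ‖x‖)]
  gcongr
  · exact (abs_sub _ _).trans (by linarith [abs_lin_le hφ x s, abs_lin_le hφ x s'])
  · exact hφ s

lemma norm_gUpd_le (s s' : S) (hw : ‖w‖ ≤ 1) (hθ : ‖θ‖ ≤ r) :
    ‖m.gUpd s s' w θ‖ ≤ 2 * m.rMax + 3 * r := by
  have hsplit : m.gUpd s s' w θ = m.R s • m.φ s + (m.lin θ s' - m.lin θ s) • m.φ s
      - (m.R s + m.lin θ s) • w := by
    simp only [gUpd]; module
  have hreward : ‖m.R s • m.φ s‖ ≤ m.rMax := by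
    rw [norm_smul, Real.norm_eq_abs, ← mul_one m.rMax]
    exact mul_le_mul (m.abs_R_le s) (hφ s) (norm_nonneg _) m.rMax_nonneg
  have hmean : ‖(m.R s + m.lin θ s) • w‖ ≤ m.rMax + r := by
    rw [norm_smul, Real.norm_eq_abs, ← mul_one (m.rMax + r)]
    exact mul_le_mul (abs_R_add_lin_le hφ hθ s) hw (norm_nonneg _)
      (add_nonneg m.rMax_nonneg ((norm_nonneg _).trans hθ))
  rw [hsplit]
  linarith [norm_sub_le (m.R s • m.φ s + (m.lin θ s' - m.lin θ s) • m.φ s)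
      ((m.R s + m.lin θ s) • w),
    norm_add_le (m.R s • m.φ s) ((m.lin θ s' - m.lin θ s) • m.φ s),
    norm_lin_sub_smul_φ_le hφ s s' θ]

lemma norm_gUpd_sub_le (s s' : S) (hw' : ‖w'‖ ≤ 1) (hθ : ‖θ‖ ≤ r) :
    ‖m.gUpd s s' w θ - m.gUpd s s' w' θ'‖ ≤ 3 * ‖θ - θ'‖ + (m.rMax + r) * ‖w - w'‖ := by
  have hsplit : m.gUpd s s' w θ - m.gUpd s s' w' θ'
      = (m.lin (θ - θ') s' - m.lin (θ - θ') s) • m.φ s - m.lin (θ - θ') s • w'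
        - (m.R s + m.lin θ s) • (w - w') := by
    simp only [gUpd, lin_sub]
    module
  have hlin : ‖m.lin (θ - θ') s • w'‖ ≤ ‖θ - θ'‖ := by
    rw [norm_smul, Real.norm_eq_abs, ← mul_one ‖θ - θ'‖]
    exact mul_le_mul (abs_lin_le hφ _ s) hw' (norm_nonneg _) (norm_nonneg _)
  have hmean : ‖(m.R s + m.lin θ s) • (w - w')‖ ≤ (m.rMax + r) * ‖w - w'‖ := by
    rw [norm_smul, Real.norm_eq_abs]
    gcongr
    exact abs_R_add_lin_le hφ hθ s
  rw [hsplit]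
  linarith [norm_sub_le ((m.lin (θ - θ') s' - m.lin (θ - θ') s) • m.φ s
      - m.lin (θ - θ') s • w') ((m.R s + m.lin θ s) • (w - w')),
    norm_sub_le ((m.lin (θ - θ') s' - m.lin (θ - θ') s) • m.φ s) (m.lin (θ - θ') s • w'),
    norm_lin_sub_smul_φ_le hφ s s' (θ - θ')]

variable (hμ : IsStationaryDist m.P μ)

include hμ

lemma norm_wStar_le : ‖m.wStar μ‖ ≤ 1 := by
  classical
  rw [wStar_eq_sum]
  exact hμ.norm_sum_smul_le m.P_mem_rowStochastic hφ

lemma eta_le_three : m.eta μ ≤ 3 := by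
  classical
  refine iInf_le_of_forall_le (by norm_num) (fun x => dirSq_add_sq_nonneg hμ _) fun x => ?_
  have hx : ‖(x : EuclideanSpace ℝ (Fin d))‖ = 1 := by simp
  have hlin : ∀ s, |m.lin x s| ≤ 1 := fun s => (abs_lin_le hφ _ s).trans_eq hx
  have hmean : (μ ⬝ᵥ m.lin x) ^ 2 ≤ 1 := (sq_le_one_iff_abs_le_one _).2
    (hμ.abs_dotProduct_le m.P_mem_rowStochastic hlin)
  linarith [hμ.dirSq_le_two m.P_mem_rowStochastic hlin]

lemma eta'_le_one : m.eta' μ ≤ 1 := by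
  classical
  refine iInf_le_of_forall_le zero_le_one
    (fun x => Finset.sum_nonneg fun s _ => mul_nonneg (hμ.nonneg s) (sq_nonneg _)) fun x => ?_
  have hx : ‖(x : EuclideanSpace ℝ (Fin d))‖ = 1 := by simp
  refine (Real.le_norm_self _).trans (hμ.norm_sum_smul_le m.P_mem_rowStochastic fun s => ?_)
  rw [norm_pow, Real.norm_eq_abs]
  exact pow_le_one₀ (abs_nonneg _) ((abs_lin_le hφ _ s).trans_eq hx)

variable [DecidableEq S]

lemma norm_gBar_le (hw : ‖w‖ ≤ 1) (hθ : ‖θ‖ ≤ r) : ‖m.gBar μ w θ‖ ≤ 2 * m.rMax + 3 * r := by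
  rw [gBar_eq_transMean]
  exact hμ.norm_transMean_le m.P_mem_rowStochastic fun s s' => norm_gUpd_le hφ s s' hw hθ

lemma norm_gBar_sub_le (hw' : ‖w'‖ ≤ 1) (hθ : ‖θ‖ ≤ r) :
    ‖m.gBar μ w θ - m.gBar μ w' θ'‖ ≤ 3 * ‖θ - θ'‖ + (m.rMax + r) * ‖w - w'‖ := by
  rw [gBar_eq_transMean, gBar_eq_transMean, ← transMean_sub]
  exact hμ.norm_transMean_le m.P_mem_rowStochastic fun s s' => norm_gUpd_sub_le hφ s s' hw' hθ

lemma inner_gBar_le (hfix : m.IsFixedPoint μ θstar) (hθ : ‖θ‖ ≤ r) :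
    inner ℝ (m.gBar μ w θ) (θ - θstar)
      ≤ -(m.eta μ * ‖θ - θstar‖ ^ 2) + (m.rMax + r) * (‖w - m.wStar μ‖ * ‖θ - θstar‖) := by
  have hdrift : inner ℝ (m.gBar μ (m.wStar μ) θ) (θ - θstar) ≤ -(m.eta μ * ‖θ - θstar‖ ^ 2) := by
    have hfixed := inner_gBar_sub_gBar hμ (m.wStar μ) θ θstar
    rw [show m.gBar μ (m.wStar μ) θstar = 0 from hfix, sub_zero, inner_wStar] at hfixed
    nlinarith [eta_mul_norm_sq_le hμ (θ - θstar)]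
  have hsplit : m.gBar μ w θ = m.gBar μ (m.wStar μ) θ
      - (μ ⬝ᵥ (m.R + m.lin θ)) • (w - m.wStar μ) := by
    simp only [gBar]; module
  have hmean : |μ ⬝ᵥ (m.R + m.lin θ)| ≤ m.rMax + r :=
    hμ.abs_dotProduct_le m.P_mem_rowStochastic (abs_R_add_lin_le hφ hθ)
  have hw : -((μ ⬝ᵥ (m.R + m.lin θ)) * inner ℝ (w - m.wStar μ) (θ - θstar))
      ≤ (m.rMax + r) * (‖w - m.wStar μ‖ * ‖θ - θstar‖) := by
    refine (neg_le_abs _).trans ?_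
    rw [abs_mul]
    exact mul_le_mul hmean (abs_real_inner_le_norm _ _) (abs_nonneg _)
      ((abs_nonneg _).trans hmean)
  rw [hsplit, inner_sub_left, real_inner_smul_left]
  linarith

/-- The cross term is split by Young's inequality with weight `lam`. -/
lemma inner_gBar_le_c₁_c₂ (hfix : m.IsFixedPoint μ θstar) (hθ : ‖θ‖ ≤ r) {lam : ℝ}
    (hlam : 0 < lam) : inner ℝ (m.gBar μ w θ) (θ - θstar)
      ≤ -(c₁ (m.eta μ) m.rMax r lam * ‖θ - θstar‖ ^ 2)
        + c₂ m.rMax r lam / 2 * ‖w - m.wStar μ‖ ^ 2 := by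
  have hr : 0 ≤ r := (norm_nonneg _).trans hθ
  have hcoeff : 0 ≤ m.rMax + 2 * r := add_nonneg m.rMax_nonneg (by positivity)
  have hyoung : ‖w - m.wStar μ‖ * ‖θ - θstar‖
      ≤ lam ^ 2 / 2 * ‖θ - θstar‖ ^ 2 + 1 / (2 * lam ^ 2) * ‖w - m.wStar μ‖ ^ 2 := by
    have hsq := sq_nonneg (lam * ‖θ - θstar‖ - ‖w - m.wStar μ‖ / lam)
    have hexpand : (lam * ‖θ - θstar‖ - ‖w - m.wStar μ‖ / lam) ^ 2
        = 2 * (lam ^ 2 / 2 * ‖θ - θstar‖ ^ 2 + 1 / (2 * lam ^ 2) * ‖w - m.wStar μ‖ ^ 2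
          - ‖w - m.wStar μ‖ * ‖θ - θstar‖) := by
      field_simp
      ring
    linarith
  calc inner ℝ (m.gBar μ w θ) (θ - θstar)
      ≤ -(m.eta μ * ‖θ - θstar‖ ^ 2)
        + (m.rMax + r) * (‖w - m.wStar μ‖ * ‖θ - θstar‖) := inner_gBar_le hφ hμ hfix hθ
    _ ≤ -(m.eta μ * ‖θ - θstar‖ ^ 2) + (m.rMax + 2 * r)
          * (lam ^ 2 / 2 * ‖θ - θstar‖ ^ 2 + 1 / (2 * lam ^ 2) * ‖w - m.wStar μ‖ ^ 2) := by
        gcongr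
        linarith
    _ = _ := by
        rw [c₁, c₂]
        field_simp
        ring

end NormalizedFeatures

/-- The fluctuation `g(s, s', w, θ) - ḡ(w, θ)` of the `θ`-update around its stationary mean. -/
def gNoise [DecidableEq S] (m : Model S A d) (μ : S → ℝ) (s s' : S)
    (w θ : EuclideanSpace ℝ (Fin d)) : EuclideanSpace ℝ (Fin d) :=
  m.gUpd s s' w θ - m.gBar μ w θ

section Noise

variable (hμ : IsStationaryDist m.P μ) (hφ : ∀ s, ‖m.φ s‖ ≤ 1)

include hμ

lemma transMean_inner_φ_sub_wStar (x : EuclideanSpace ℝ (Fin d)) :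
    transMean m.P μ (fun s _ => inner ℝ (m.φ s - m.wStar μ) x) = 0 := by
  classical
  rw [← inner_transMean, transMean_sub, hμ.transMean_const m.P_mem_rowStochastic,
    transMean_eq_sum m.P_mem_rowStochastic, wStar_eq_sum, sub_self, inner_zero_left]

include hφ in
lemma norm_φ_sub_wStar_le (s : S) : ‖m.φ s - m.wStar μ‖ ≤ 2 :=
  (norm_sub_le _ _).trans (by linarith [hφ s, norm_wStar_le hφ hμ])

variable [DecidableEq S]

lemma transMean_inner_gNoise (w θ x : EuclideanSpace ℝ (Fin d)) :
    transMean m.P μ (fun s s' => inner ℝ (m.gNoise μ s s' w θ) x) = 0 := by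
  rw [← inner_transMean]
  simp only [gNoise]
  rw [transMean_sub, hμ.transMean_const m.P_mem_rowStochastic, gBar_eq_transMean, sub_self,
    inner_zero_left]

include hφ

lemma norm_gNoise_le (s s' : S) (hw : ‖w‖ ≤ 1) (hθ : ‖θ‖ ≤ r) :
    ‖m.gNoise μ s s' w θ‖ ≤ 2 * (2 * m.rMax + 3 * r) :=
  (norm_sub_le _ _).trans
    (by linarith [norm_gUpd_le hφ s s' hw hθ, norm_gBar_le hφ hμ hw hθ])

lemma norm_gNoise_sub_le (s s' : S) (hw' : ‖w'‖ ≤ 1) (hθ : ‖θ‖ ≤ r) :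
    ‖m.gNoise μ s s' w θ - m.gNoise μ s s' w' θ'‖
      ≤ 2 * (3 * ‖θ - θ'‖ + (m.rMax + r) * ‖w - w'‖) := by
  rw [gNoise, gNoise, sub_sub_sub_comm]
  exact (norm_sub_le _ _).trans (by
    linarith [norm_gUpd_sub_le hφ s s' (w := w) (θ' := θ') hw' hθ,
      norm_gBar_sub_le hφ hμ (w := w) (θ' := θ') hw' hθ])

/-- Frozen iterates `(v, u)` may replace `(w, θ)` in the noise term at the price of their
displacement. -/
lemma inner_gNoise_le_frozen (s s' : S) {v u : EuclideanSpace ℝ (Fin d)} {δw δθ : ℝ}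
    (hv : ‖v‖ ≤ 1) (hu : ‖u‖ ≤ r) (hθ : ‖θ‖ ≤ r) (hstar : ‖θstar‖ ≤ r) (hδw : ‖w - v‖ ≤ δw)
    (hδθ : ‖θ - u‖ ≤ δθ) :
    inner ℝ (m.gNoise μ s s' w θ) (θ - θstar)
      ≤ inner ℝ (m.gNoise μ s s' v u) (u - θstar) + 2 * (2 * m.rMax + 3 * r) * δθ
        + 2 * (3 * δθ + (m.rMax + r) * δw) * (2 * r) := by
  have hr : 0 ≤ r := (norm_nonneg _).trans hθ
  have hrMax := m.rMax_nonneg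
  have hδθ0 : 0 ≤ δθ := (norm_nonneg _).trans hδθ
  have hδw0 : 0 ≤ δw := (norm_nonneg _).trans hδw
  have herror : ‖θ - θstar‖ ≤ 2 * r := (norm_sub_le _ _).trans (by linarith)
  refine (inner_le_inner_add _ (m.gNoise μ s s' v u) _ (u - θstar)).trans ?_
  rw [sub_sub_sub_cancel_right]
  gcongr
  · exact norm_gNoise_le hμ hφ s s' hv hu
  · exact (norm_gNoise_sub_le hμ hφ s s' hv hθ).trans (by gcongr)

end Noise

end Model

namespace Model

variable {S A : Type*} [Fintype S] [Fintype A] {d : ℕ} {m : Model S A d}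

section OneStep

variable {μ : S → ℝ} {p : EuclideanSpace ℝ (Fin d) × EuclideanSpace ℝ (Fin d)}
  {v u θstar : EuclideanSpace ℝ (Fin d)} {α β Rw Rθ lam δw δθ : ℝ}
  (hφ : ∀ s, ‖m.φ s‖ ≤ 1)

include hφ

lemma norm_add_smul_fUpd_le {w : EuclideanSpace ℝ (Fin d)} (hw : ‖w‖ ≤ 1) (hβ : 0 ≤ β)
    (hβ1 : β ≤ 1) (s : S) : ‖w + β • m.fUpd s w‖ ≤ 1 := by
  have hconvex : w + β • m.fUpd s w = (1 - β) • w + β • m.φ s := by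
    simp only [fUpd]; module
  rw [hconvex]
  refine (norm_add_le _ _).trans ?_
  rw [norm_smul, norm_smul, Real.norm_of_nonneg hβ, Real.norm_of_nonneg (sub_nonneg.2 hβ1)]
  nlinarith [hφ s]

lemma next_fst (hp : ‖p.1‖ ≤ 1) (hβ : 0 ≤ β) (hβ1 : β ≤ 1) (hRw : 1 ≤ Rw) (s s' : S) :
    (m.next α β Rw Rθ s s' p).1 = p.1 + β • m.fUpd s p.1 :=
  projBall_of_norm_le ((norm_add_smul_fUpd_le hφ hp hβ hβ1 s).trans hRw)

lemma norm_fUpd_le {w : EuclideanSpace ℝ (Fin d)} (hw : ‖w‖ ≤ 1) (s : S) :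
    ‖m.fUpd s w‖ ≤ 2 :=
  (norm_sub_le _ _).trans (by linarith [hφ s])

lemma norm_next_fst_sub_le (hp : ‖p.1‖ ≤ 1) (hβ : 0 ≤ β) (hβ1 : β ≤ 1) (hRw : 1 ≤ Rw)
    (s s' : S) : ‖(m.next α β Rw Rθ s s' p).1 - p.1‖ ≤ 2 * β := by
  rw [next_fst hφ hp hβ hβ1 hRw, add_sub_cancel_left, norm_smul, Real.norm_of_nonneg hβ, mul_comm]
  exact mul_le_mul_of_nonneg_right (norm_fUpd_le hφ hp s) hβ

lemma norm_next_snd_sub_le (hp : ‖p.1‖ ≤ 1) (hp' : ‖p.2‖ ≤ Rθ) (hα : 0 ≤ α) (s s' : S) :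
    ‖(m.next α β Rw Rθ s s' p).2 - p.2‖ ≤ (2 * m.rMax + 3 * Rθ) * α := by
  refine (norm_projBall_sub_le ((norm_nonneg _).trans hp') _ hp').trans ?_
  rw [add_sub_cancel_left, norm_smul, Real.norm_of_nonneg hα, mul_comm]
  exact mul_le_mul_of_nonneg_right (norm_gUpd_le hφ s s' hp hp') hα

variable (hμ : IsStationaryDist m.P μ)

include hμ

lemma norm_next_fst_sub_wStar_sq_le (hp : ‖p.1‖ ≤ 1) (hδ : ‖p.1 - v‖ ≤ δw) (hβ : 0 ≤ β)
    (hβ1 : β ≤ 1) (hRw : 1 ≤ Rw) (s s' : S) :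
    ‖(m.next α β Rw Rθ s s' p).1 - m.wStar μ‖ ^ 2
      ≤ (1 - 2 * β) * ‖p.1 - m.wStar μ‖ ^ 2
        + 2 * β * inner ℝ (m.φ s - m.wStar μ) (v - m.wStar μ) + (4 * β * δw + 4 * β ^ 2) := by
  have hinner : inner ℝ (m.fUpd s p.1) (p.1 - m.wStar μ)
      ≤ inner ℝ (m.φ s - m.wStar μ) (v - m.wStar μ) + 2 * δw - ‖p.1 - m.wStar μ‖ ^ 2 := by
    have hsplit : inner ℝ (m.fUpd s p.1) (p.1 - m.wStar μ)
        = inner ℝ (m.φ s - m.wStar μ) (p.1 - m.wStar μ) - ‖p.1 - m.wStar μ‖ ^ 2 := by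
      rw [← real_inner_self_eq_norm_sq, ← inner_sub_left, sub_sub_sub_cancel_right, fUpd]
    have hfrozen := inner_le_inner_add (m.φ s - m.wStar μ) (m.φ s - m.wStar μ)
      (p.1 - m.wStar μ) (v - m.wStar μ)
    rw [sub_sub_sub_cancel_right, sub_self, norm_zero, zero_mul, add_zero] at hfrozen
    have hprod : ‖m.φ s - m.wStar μ‖ * ‖p.1 - v‖ ≤ 2 * δw :=
      mul_le_mul (norm_φ_sub_wStar_le hμ hφ s) hδ (norm_nonneg _) zero_le_two
    linarith
  have hsq : ‖m.fUpd s p.1‖ ^ 2 ≤ 2 ^ 2 := by gcongr; exact norm_fUpd_le hφ hp s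
  rw [next_fst hφ hp hβ hβ1 hRw, add_sub_right_comm, norm_add_smul_sq]
  nlinarith [mul_le_mul_of_nonneg_left hinner hβ, mul_le_mul_of_nonneg_left hsq (sq_nonneg β)]

lemma norm_next_snd_sub_sq_le [DecidableEq S] (hfix : m.IsFixedPoint μ θstar) (hstar : ‖θstar‖ ≤ Rθ)
    (hlam : 0 < lam) (hp : ‖p.1‖ ≤ 1) (hp' : ‖p.2‖ ≤ Rθ) (hv : ‖v‖ ≤ 1) (hu : ‖u‖ ≤ Rθ)
    (hδw : ‖p.1 - v‖ ≤ δw) (hδθ : ‖p.2 - u‖ ≤ δθ) (hα : 0 ≤ α) (s s' : S) :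
    ‖(m.next α β Rw Rθ s s' p).2 - θstar‖ ^ 2
      ≤ (1 - 2 * α * c₁ (m.eta μ) m.rMax Rθ lam) * ‖p.2 - θstar‖ ^ 2
        + α * c₂ m.rMax Rθ lam * ‖p.1 - m.wStar μ‖ ^ 2
        + 2 * α * inner ℝ (m.gNoise μ s s' v u) (u - θstar)
        + (2 * α * (2 * (2 * m.rMax + 3 * Rθ) * δθ
            + 2 * (3 * δθ + (m.rMax + Rθ) * δw) * (2 * Rθ))
          + α ^ 2 * (2 * m.rMax + 3 * Rθ) ^ 2) := by
  have hproj : ‖(m.next α β Rw Rθ s s' p).2 - θstar‖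
      ≤ ‖p.2 - θstar + α • m.gUpd s s' p.1 p.2‖ := by
    rw [← add_sub_right_comm]
    exact norm_projBall_sub_le ((norm_nonneg _).trans hp') _ hstar
  have hsplit : inner ℝ (m.gUpd s s' p.1 p.2) (p.2 - θstar)
      = inner ℝ (m.gBar μ p.1 p.2) (p.2 - θstar)
        + inner ℝ (m.gNoise μ s s' p.1 p.2) (p.2 - θstar) := by
    rw [← inner_add_left, gNoise, add_sub_cancel]
  have hinner := add_le_add (inner_gBar_le_c₁_c₂ hφ hμ (w := p.1) hfix hp' hlam)
    (inner_gNoise_le_frozen hμ hφ s s' hv hu hp' hstar hδw hδθ)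
  rw [← hsplit] at hinner
  calc ‖(m.next α β Rw Rθ s s' p).2 - θstar‖ ^ 2
      ≤ ‖p.2 - θstar + α • m.gUpd s s' p.1 p.2‖ ^ 2 := by gcongr
    _ = ‖p.2 - θstar‖ ^ 2 + 2 * α * inner ℝ (m.gUpd s s' p.1 p.2) (p.2 - θstar)
        + α ^ 2 * ‖m.gUpd s s' p.1 p.2‖ ^ 2 := norm_add_smul_sq _ _ _
    _ ≤ ‖p.2 - θstar‖ ^ 2
        + 2 * α * (-(c₁ (m.eta μ) m.rMax Rθ lam * ‖p.2 - θstar‖ ^ 2)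
          + c₂ m.rMax Rθ lam / 2 * ‖p.1 - m.wStar μ‖ ^ 2
          + (inner ℝ (m.gNoise μ s s' v u) (u - θstar) + 2 * (2 * m.rMax + 3 * Rθ) * δθ
            + 2 * (3 * δθ + (m.rMax + Rθ) * δw) * (2 * Rθ)))
        + α ^ 2 * (2 * m.rMax + 3 * Rθ) ^ 2 := by
        gcongr
        exact norm_gUpd_le hφ s s' hp hp'
    _ = _ := by ring

end OneStep

lemma dependsOn_iterates (m : Model S A d) (α β : ℕ → ℝ) (Rw Rθ : ℝ)
    (w₀ θ₀ : EuclideanSpace ℝ (Fin d)) (t : ℕ) :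
    DependsOn (fun x => m.iterates α β Rw Rθ w₀ θ₀ x t) (Set.Iic t) := by
  induction t with
  | zero => exact fun _ _ _ => rfl
  | succ t ih =>
    intro x y h
    simp only [iterates, h t t.le_succ, h (t + 1) Set.self_mem_Iic,
      ih fun i hi => h i (Nat.le_succ_of_le hi)]

/-- The standing assumptions on a run of the algorithm: normalized features, nonincreasing step
sizes, the one of the mean estimate being at most `1`, and initial points in the unit ball and in
the projection ball respectively. -/
structure IsRun (m : Model S A d) (α β : ℕ → ℝ) (Rw Rθ : ℝ)
    (w₀ θ₀ : EuclideanSpace ℝ (Fin d)) : Prop where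
  norm_φ_le : ∀ s, ‖m.φ s‖ ≤ 1
  α_nonneg : ∀ t, 0 ≤ α t
  α_antitone : Antitone α
  β_nonneg : ∀ t, 0 ≤ β t
  β_le_one : ∀ t, β t ≤ 1
  β_antitone : Antitone β
  one_le_Rw : 1 ≤ Rw
  norm_w₀_le : ‖w₀‖ ≤ 1
  norm_θ₀_le : ‖θ₀‖ ≤ Rθ

end Model

lemma norm_add_sub_le_of_forall_norm_succ_sub_le {E : Type*} [SeminormedAddCommGroup E]
    {u : ℕ → E} {γ : ℕ → ℝ} {c : ℝ} (hc : 0 ≤ c) (hγ : Antitone γ)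
    (hu : ∀ t, ‖u (t + 1) - u t‖ ≤ c * γ t) (n k : ℕ) : ‖u (n + k) - u n‖ ≤ k * (c * γ n) := by
  induction k with
  | zero => simp
  | succ k ih =>
    have hstep : ‖u (n + k + 1) - u (n + k)‖ ≤ c * γ n :=
      (hu (n + k)).trans (mul_le_mul_of_nonneg_left (hγ (Nat.le_add_right n k)) hc)
    have htriangle := norm_sub_le_norm_sub_add_norm_sub (u (n + k + 1)) (u (n + k)) (u n)
    push_cast
    rw [← add_assoc]
    linarith

lemma integral_le_of_le_add_mul_add {Ω : Type*} [MeasurableSpace Ω] {ℙ : Measure Ω}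
    [IsProbabilityMeasure ℙ] {f g N : Ω → ℝ} {p q e : ℝ} (hf : Integrable f ℙ)
    (hg : Integrable g ℙ) (hN : Integrable N ℙ) (hle : ∀ ω, f ω ≤ g ω + p * N ω + q)
    (hp : 0 ≤ p) (he : ∫ ω, N ω ∂ℙ ≤ e) :
    ∫ ω, f ω ∂ℙ ≤ ∫ ω, g ω ∂ℙ + p * e + q := by
  have hgN : Integrable (fun ω => g ω + p * N ω) ℙ := hg.add (hN.const_mul p)
  calc ∫ ω, f ω ∂ℙ ≤ ∫ ω, (g ω + p * N ω + q) ∂ℙ :=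
        integral_mono hf (hgN.add (integrable_const q)) hle
    _ = ∫ ω, g ω ∂ℙ + p * ∫ ω, N ω ∂ℙ + q := by
        rw [integral_add hgN (integrable_const q), integral_add hg (hN.const_mul p),
          integral_const_mul]
        simp
    _ ≤ _ := by gcongr

namespace Model.IsRun

variable {S A : Type*} [Fintype S] [Fintype A] {d : ℕ} {m : Model S A d} {α β : ℕ → ℝ}
  {Rw Rθ : ℝ} {w₀ θ₀ : EuclideanSpace ℝ (Fin d)} (h : m.IsRun α β Rw Rθ w₀ θ₀)

local notation "Z" => m.iterates α β Rw Rθ w₀ θ₀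

include h

lemma Rθ_nonneg : 0 ≤ Rθ := (norm_nonneg _).trans h.norm_θ₀_le

lemma norm_fst_le (x : ℕ → S) (t : ℕ) : ‖(Z x t).1‖ ≤ 1 := by
  induction t with
  | zero => exact h.norm_w₀_le
  | succ t ih =>
    rw [iterates, next_fst h.norm_φ_le ih (h.β_nonneg t) (h.β_le_one t) h.one_le_Rw]
    exact norm_add_smul_fUpd_le h.norm_φ_le ih (h.β_nonneg t) (h.β_le_one t) _

lemma norm_snd_le (x : ℕ → S) (t : ℕ) : ‖(Z x t).2‖ ≤ Rθ := by
  cases t with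
  | zero => exact h.norm_θ₀_le
  | succ t => exact norm_projBall_le h.Rθ_nonneg _

lemma norm_fst_add_sub_le (x : ℕ → S) {n k : ℕ} (hβ : β n ≤ 2 * β (n + k)) :
    ‖(Z x (n + k)).1 - (Z x n).1‖ ≤ 4 * k * β (n + k) := by
  refine (norm_add_sub_le_of_forall_norm_succ_sub_le zero_le_two h.β_antitone
    (u := fun t => (Z x t).1) (fun t => norm_next_fst_sub_le h.norm_φ_le (h.norm_fst_le x t)
      (h.β_nonneg t) (h.β_le_one t) h.one_le_Rw _ _) n k).trans ?_
  calc k * (2 * β n) ≤ k * (2 * (2 * β (n + k))) := by gcongr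
    _ = _ := by ring

lemma norm_snd_add_sub_le (x : ℕ → S) {n k : ℕ} (hα : α n ≤ 2 * α (n + k)) :
    ‖(Z x (n + k)).2 - (Z x n).2‖ ≤ 2 * k * (2 * m.rMax + 3 * Rθ) * α (n + k) := by
  have hcoeff : 0 ≤ 2 * m.rMax + 3 * Rθ := by linarith [m.rMax_nonneg, h.Rθ_nonneg]
  refine (norm_add_sub_le_of_forall_norm_succ_sub_le hcoeff h.α_antitone
    (u := fun t => (Z x t).2) (fun t => norm_next_snd_sub_le h.norm_φ_le (h.norm_fst_le x t)
      (h.norm_snd_le x t) (h.α_nonneg t) _ _) n k).trans ?_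
  calc k * ((2 * m.rMax + 3 * Rθ) * α n)
      ≤ k * ((2 * m.rMax + 3 * Rθ) * (2 * α (n + k))) := by gcongr
    _ = _ := by ring

lemma norm_snd_sub_le {θstar : EuclideanSpace ℝ (Fin d)} (hstar : ‖θstar‖ ≤ Rθ) (x : ℕ → S)
    (t : ℕ) : ‖(Z x t).2 - θstar‖ ≤ 2 * Rθ :=
  (norm_sub_le _ _).trans (by linarith [h.norm_snd_le x t])

variable {μ : S → ℝ} (hμ : IsStationaryDist m.P μ)

include hμ in
lemma norm_fst_sub_wStar_le (x : ℕ → S) (t : ℕ) : ‖(Z x t).1 - m.wStar μ‖ ≤ 2 :=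
  (norm_sub_le _ _).trans (by linarith [h.norm_fst_le x t, norm_wStar_le h.norm_φ_le hμ])

variable {Ω : Type*} [MeasurableSpace Ω] {ℙ : Measure Ω} [IsProbabilityMeasure ℙ]
  {s : ℕ → Ω → S} (hs : IsMarkovChain m.P ℙ s)

omit h in
include hs in
lemma integrable_iterates (f : EuclideanSpace ℝ (Fin d) × EuclideanSpace ℝ (Fin d) → ℝ) (t : ℕ) :
    Integrable (fun ω => f (Z (fun i => s i ω) t)) ℙ :=
  integrable_of_dependsOn hs.measurable (f := fun x => f (Z x t)) fun _ _ hxy =>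
    congrArg f (m.dependsOn_iterates α β Rw Rθ w₀ θ₀ t hxy)

include hs

lemma integral_norm_snd_sub_sq_le {θstar : EuclideanSpace ℝ (Fin d)} (hstar : ‖θstar‖ ≤ Rθ)
    (t : ℕ) : ∫ ω, ‖(Z (fun i => s i ω) t).2 - θstar‖ ^ 2 ∂ℙ ≤ 4 * Rθ ^ 2 := by
  refine (integral_mono (integrable_iterates hs (fun z => ‖z.2 - θstar‖ ^ 2) t)
    (integrable_const (4 * Rθ ^ 2)) fun ω => ?_).trans (by simp)
  refine (pow_le_pow_left₀ (norm_nonneg _) (h.norm_snd_sub_le hstar _ t) 2).trans_eq ?_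
  ring

include hμ

lemma integral_norm_fst_sub_sq_le (t : ℕ) :
    ∫ ω, ‖(Z (fun i => s i ω) t).1 - m.wStar μ‖ ^ 2 ∂ℙ ≤ 4 := by
  refine (integral_mono (integrable_iterates hs (fun z => ‖z.1 - m.wStar μ‖ ^ 2) t)
    (integrable_const 4) fun ω => ?_).trans (by simp)
  exact (pow_le_pow_left₀ (norm_nonneg _) (h.norm_fst_sub_wStar_le hμ _ t) 2).trans_eq
    (by norm_num)

variable [DecidableEq S]

section Noise

variable {n k : ℕ}

lemma integral_inner_φ_sub_wStar_le {ε : ℝ} (hmix : ∀ y, mixDist m.P μ k y ≤ ε) :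
    ∫ ω, inner ℝ (m.φ (s (n + k) ω) - m.wStar μ) ((Z (fun i => s i ω) n).1 - m.wStar μ) ∂ℙ
      ≤ 4 * ε := by
  refine hs.integral_transition_le m.P_mem_rowStochastic (B := 4) (μ := μ)
    (F := fun x y _ => inner ℝ (m.φ y - m.wStar μ) ((Z x n).1 - m.wStar μ))
    (fun y _ x x' hx => ?_) (fun x => transMean_inner_φ_sub_wStar hμ _) (fun x y _ => ?_) hmix
  · simp only [m.dependsOn_iterates α β Rw Rθ w₀ θ₀ n hx]
  · calc _ ≤ ‖m.φ y - m.wStar μ‖ * ‖(Z x n).1 - m.wStar μ‖ := abs_real_inner_le_norm _ _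
      _ ≤ 2 * 2 := mul_le_mul (norm_φ_sub_wStar_le hμ h.norm_φ_le y)
          (h.norm_fst_sub_wStar_le hμ x n) (norm_nonneg _) zero_le_two
      _ = 4 := by norm_num

lemma integral_inner_gNoise_le {θstar : EuclideanSpace ℝ (Fin d)} (hstar : ‖θstar‖ ≤ Rθ) {ε : ℝ}
    (hmix : ∀ y, mixDist m.P μ k y ≤ ε) :
    ∫ ω, inner ℝ (m.gNoise μ (s (n + k) ω) (s (n + k + 1) ω) (Z (fun i => s i ω) n).1
        (Z (fun i => s i ω) n).2) ((Z (fun i => s i ω) n).2 - θstar) ∂ℙ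
      ≤ 2 * (m.rMax + 3 * Rθ) ^ 2 * ε := by
  have hr := m.rMax_nonneg
  have hR := h.Rθ_nonneg
  refine hs.integral_transition_le m.P_mem_rowStochastic (B := 2 * (m.rMax + 3 * Rθ) ^ 2) (μ := μ)
    (F := fun x y z => inner ℝ (m.gNoise μ y z (Z x n).1 (Z x n).2) ((Z x n).2 - θstar))
    (fun y z x x' hx => ?_) (fun x => transMean_inner_gNoise hμ _ _ _) (fun x y z => ?_) hmix
  · simp only [m.dependsOn_iterates α β Rw Rθ w₀ θ₀ n hx]
  · calc _ ≤ ‖m.gNoise μ y z (Z x n).1 (Z x n).2‖ * ‖(Z x n).2 - θstar‖ :=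
          abs_real_inner_le_norm _ _
      _ ≤ 2 * (2 * m.rMax + 3 * Rθ) * (2 * Rθ) :=
          mul_le_mul (norm_gNoise_le hμ h.norm_φ_le y z (h.norm_fst_le x n) (h.norm_snd_le x n))
            (h.norm_snd_sub_le hstar x n) (norm_nonneg _) (by positivity)
      _ ≤ 2 * (m.rMax + 3 * Rθ) ^ 2 := by
          nlinarith [mul_nonneg hr hR, sq_nonneg m.rMax, sq_nonneg Rθ]

end Noise

lemma integral_fst_succ_le {n k : ℕ} (hβ : β n ≤ 2 * β (n + k))
    (hmix : ∀ y, mixDist m.P μ k y ≤ β (n + k)) :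
    ∫ ω, ‖(Z (fun i => s i ω) (n + k + 1)).1 - m.wStar μ‖ ^ 2 ∂ℙ
      ≤ (1 - 2 * β (n + k)) * ∫ ω, ‖(Z (fun i => s i ω) (n + k)).1 - m.wStar μ‖ ^ 2 ∂ℙ
        + (16 * k + 12) * β (n + k) ^ 2 := by
  have hβ0 := h.β_nonneg (n + k)
  have hN : Integrable (fun ω => inner ℝ (m.φ (s (n + k) ω) - m.wStar μ)
      ((Z (fun i => s i ω) n).1 - m.wStar μ)) ℙ :=
    integrable_of_dependsOn hs.measurable (n := n + k)
      (f := fun x => inner ℝ (m.φ (x (n + k)) - m.wStar μ) ((Z x n).1 - m.wStar μ))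
      fun x x' hx => by
        simp only [hx (n + k) Set.self_mem_Iic, m.dependsOn_iterates α β Rw Rθ w₀ θ₀ n
          fun i hi => hx i (Nat.le_add_right_of_le hi)]
  have hstep := integral_le_of_le_add_mul_add
    (integrable_iterates hs (fun z => ‖z.1 - m.wStar μ‖ ^ 2) (n + k + 1))
    ((integrable_iterates hs (fun z => ‖z.1 - m.wStar μ‖ ^ 2) (n + k)).const_mul
      (1 - 2 * β (n + k))) hN
    (fun ω => norm_next_fst_sub_wStar_sq_le h.norm_φ_le hμ (h.norm_fst_le _ _)
      (h.norm_fst_add_sub_le _ hβ) hβ0 (h.β_le_one _) h.one_le_Rw _ _)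
    (by positivity) (h.integral_inner_φ_sub_wStar_le hμ hs hmix)
  rw [integral_const_mul] at hstep
  exact hstep.trans_eq (by ring)

lemma integral_snd_succ_le {θstar : EuclideanSpace ℝ (Fin d)} {lam : ℝ}
    (hfix : m.IsFixedPoint μ θstar) (hstar : ‖θstar‖ ≤ Rθ) (hlam : 0 < lam) {n k : ℕ}
    (hα : α n ≤ 2 * α (n + k)) (hβ : β n ≤ 2 * β (n + k))
    (hmix : ∀ y, mixDist m.P μ k y ≤ α (n + k)) :
    ∫ ω, ‖(Z (fun i => s i ω) (n + k + 1)).2 - θstar‖ ^ 2 ∂ℙ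
      ≤ (1 - 2 * α (n + k) * c₁ (m.eta μ) m.rMax Rθ lam)
          * ∫ ω, ‖(Z (fun i => s i ω) (n + k)).2 - θstar‖ ^ 2 ∂ℙ
        + α (n + k) * c₂ m.rMax Rθ lam
          * ∫ ω, ‖(Z (fun i => s i ω) (n + k)).1 - m.wStar μ‖ ^ 2 ∂ℙ
        + ((48 * α (n + k) + 32 * β (n + k)) * k * α (n + k) + 8 * α (n + k) ^ 2)
          * (m.rMax + 3 * Rθ) ^ 2 := by
  have hr := m.rMax_nonneg
  have hR := h.Rθ_nonneg
  have hα0 := h.α_nonneg (n + k)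
  have hβ0 := h.β_nonneg (n + k)
  have hN : Integrable (fun ω => inner ℝ (m.gNoise μ (s (n + k) ω) (s (n + k + 1) ω)
      (Z (fun i => s i ω) n).1 (Z (fun i => s i ω) n).2) ((Z (fun i => s i ω) n).2 - θstar)) ℙ :=
    integrable_of_dependsOn hs.measurable (n := n + k + 1)
      (f := fun x => inner ℝ (m.gNoise μ (x (n + k)) (x (n + k + 1)) (Z x n).1 (Z x n).2)
        ((Z x n).2 - θstar)) fun x x' hx => by
        simp only [hx (n + k) (Nat.le_succ _), hx (n + k + 1) Set.self_mem_Iic,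
          m.dependsOn_iterates α β Rw Rθ w₀ θ₀ n
            fun i hi => hx i (Nat.le_succ_of_le (Nat.le_add_right_of_le hi))]
  have hX : Integrable (fun ω => (1 - 2 * α (n + k) * c₁ (m.eta μ) m.rMax Rθ lam)
      * ‖(Z (fun i => s i ω) (n + k)).2 - θstar‖ ^ 2) ℙ :=
    (integrable_iterates hs (fun z => ‖z.2 - θstar‖ ^ 2) _).const_mul _
  have hY : Integrable (fun ω => α (n + k) * c₂ m.rMax Rθ lam
      * ‖(Z (fun i => s i ω) (n + k)).1 - m.wStar μ‖ ^ 2) ℙ :=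
    (integrable_iterates hs (fun z => ‖z.1 - m.wStar μ‖ ^ 2) _).const_mul _
  have hstep := integral_le_of_le_add_mul_add
    (integrable_iterates hs (fun z => ‖z.2 - θstar‖ ^ 2) (n + k + 1)) (hX.add hY) hN
    (fun ω => norm_next_snd_sub_sq_le h.norm_φ_le hμ hfix hstar hlam (h.norm_fst_le _ _)
      (h.norm_snd_le _ _) (h.norm_fst_le _ _) (h.norm_snd_le _ _) (h.norm_fst_add_sub_le _ hβ)
      (h.norm_snd_add_sub_le _ hα) hα0 _ _)
    (by positivity) (h.integral_inner_gNoise_le hμ hs hstar hmix)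
  simp only [Pi.add_apply] at hstep
  rw [integral_add hX hY, integral_const_mul, integral_const_mul] at hstep
  have hconst : 0 ≤ α (n + k) * (k * (α (n + k) * (16 * m.rMax ^ 2 + 96 * m.rMax * Rθ
      + 216 * Rθ ^ 2) + 32 * β (n + k) * (m.rMax ^ 2 + 5 * m.rMax * Rθ + 8 * Rθ ^ 2)))
      + α (n + k) ^ 2 * (12 * m.rMax * Rθ + 27 * Rθ ^ 2) := by positivity
  linarith

end Model.IsRun

section Powers

variable {u p s ξ a : ℝ}

lemma add_one_rpow_eq (hu : 0 < u) (p : ℝ) : (u + 1) ^ p = u ^ p * (1 + 1 / u) ^ p := by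
  rw [← Real.mul_rpow hu.le (by positivity), mul_add, mul_one, mul_one_div_cancel hu.ne']

lemma one_sub_div_mul_add_one_rpow_le (hu : 0 < u) (hp : 0 ≤ p) :
    (1 - p / u) * (u + 1) ^ p ≤ u ^ p := by
  have hpow : (1 + 1 / u) ^ p ≤ Real.exp (p / u) := by
    calc (1 + 1 / u) ^ p ≤ Real.exp (1 / u) ^ p := by
          gcongr; linarith [Real.add_one_le_exp (1 / u)]
      _ = Real.exp (p / u) := by rw [← Real.exp_mul, one_div_mul_eq_div]
  calc (1 - p / u) * (u + 1) ^ p ≤ Real.exp (-(p / u)) * (u ^ p * Real.exp (p / u)) := by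
        rw [add_one_rpow_eq hu]
        gcongr
        exact Real.one_sub_le_exp_neg _
    _ = u ^ p := by rw [mul_left_comm, ← Real.exp_add, neg_add_cancel, Real.exp_zero, mul_one]

lemma mul_rpow_neg_sub_one_le (hu : 1 < u) (hs : 0 ≤ s) :
    s * u ^ (-s - 1) ≤ (u - 1) ^ (-s) - u ^ (-s) := by
  have hu0 : 0 < u := one_pos.trans hu
  have hbase : u - 1 ≤ u * Real.exp (-(1 / u)) := by
    calc u - 1 = u * (1 - 1 / u) := by field_simp
      _ ≤ _ := by gcongr; exact Real.one_sub_le_exp_neg _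
  have hpow : u ^ (-s) * (1 + s / u) ≤ (u - 1) ^ (-s) := by
    calc u ^ (-s) * (1 + s / u) ≤ u ^ (-s) * Real.exp (s / u) := by
          gcongr; linarith [Real.add_one_le_exp (s / u)]
      _ = (u * Real.exp (-(1 / u))) ^ (-s) := by
          rw [Real.mul_rpow hu0.le (Real.exp_pos _).le, ← Real.exp_mul, neg_mul_neg,
            one_div_mul_eq_div]
      _ ≤ (u - 1) ^ (-s) :=
          Real.rpow_le_rpow_of_nonpos (sub_pos.2 hu) hbase (neg_nonpos.2 hs)
  rw [Real.rpow_sub_one hu0.ne']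
  linarith [show u ^ (-s) * (1 + s / u) = u ^ (-s) + s * (u ^ (-s) / u) by ring]

lemma one_div_le_log_sub_log (hu : 1 < u) : 1 / u ≤ Real.log u - Real.log (u - 1) := by
  have hu1 : 0 < u - 1 := sub_pos.2 hu
  have hlog := Real.one_sub_inv_le_log_of_pos (show 0 < u / (u - 1) by positivity)
  rw [Real.log_div (by positivity) hu1.ne', inv_div] at hlog
  refine le_trans (le_of_eq ?_) hlog
  field_simp
  ring

lemma add_one_rpow_le (hu : 1 ≤ u) (hp : 0 ≤ p) : (u + 1) ^ p ≤ 2 ^ p * u ^ p := by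
  rw [← Real.mul_rpow zero_le_two (by linarith)]
  gcongr
  linarith

lemma div_rpow_mul_one_sub_le (hu : 1 ≤ u) (hξ0 : 0 ≤ ξ) (hξ1 : ξ ≤ 1) (ha : 0 ≤ a) :
    a / u ^ ξ * (1 - ξ / u) ≤ a / (u + 1) ^ ξ := by
  have hu0 : 0 < u := one_pos.trans_le hu
  have hbernoulli : (1 + 1 / u) ^ ξ ≤ 1 + ξ * (1 / u) :=
    rpow_one_add_le_one_add_mul_self (by linarith [one_div_pos.2 hu0]) hξ0 hξ1
  have hfactor : 0 ≤ 1 - ξ / u := sub_nonneg.2 (div_le_one_of_le₀ (hξ1.trans hu) hu0.le)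
  have hle : (1 - ξ / u) * (1 + 1 / u) ^ ξ ≤ 1 := by
    calc (1 - ξ / u) * (1 + 1 / u) ^ ξ ≤ (1 - ξ / u) * (1 + ξ * (1 / u)) := by gcongr
      _ = 1 - (ξ / u) ^ 2 := by ring
      _ ≤ 1 := sub_le_self _ (sq_nonneg _)
  rw [add_one_rpow_eq hu0, ← div_div, le_div_iff₀ (by positivity), mul_assoc]
  exact mul_le_of_le_one_right (by positivity) hle

lemma add_one_rpow_one_sub_sub_le (hu : 1 ≤ u) (hξ0 : 0 ≤ ξ) (hξ1 : ξ ≤ 1) :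
    (u + 1) ^ (1 - ξ) - u ^ (1 - ξ) ≤ (1 - ξ) / u ^ ξ := by
  have hu0 : 0 < u := one_pos.trans_le hu
  have hbernoulli : (1 + 1 / u) ^ (1 - ξ) ≤ 1 + (1 - ξ) * (1 / u) :=
    rpow_one_add_le_one_add_mul_self (by linarith [one_div_pos.2 hu0]) (by linarith)
      (by linarith)
  rw [add_one_rpow_eq hu0, sub_le_iff_le_add]
  calc u ^ (1 - ξ) * (1 + 1 / u) ^ (1 - ξ) ≤ u ^ (1 - ξ) * (1 + (1 - ξ) * (1 / u)) := by gcongr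
    _ = (1 - ξ) / u ^ ξ + u ^ (1 - ξ) := by
      rw [Real.rpow_sub hu0, Real.rpow_one]; field_simp; ring

lemma le_add_one_rpow_one_sub_sub (hu : 0 ≤ u) (hξ0 : 0 ≤ ξ) (hξ1 : ξ ≤ 1) :
    (1 - ξ) / (u + 1) ^ ξ ≤ (u + 1) ^ (1 - ξ) - u ^ (1 - ξ) := by
  have hu1 : 0 < u + 1 := by linarith
  have hinv : 1 / (u + 1) ≤ 1 := div_le_one_of_le₀ (by linarith) hu1.le
  have hbernoulli : (1 + -(1 / (u + 1))) ^ (1 - ξ) ≤ 1 + (1 - ξ) * (-(1 / (u + 1))) :=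
    rpow_one_add_le_one_add_mul_self (by linarith) (by linarith) (by linarith)
  rw [le_sub_comm]
  calc u ^ (1 - ξ) = (u + 1) ^ (1 - ξ) * (1 + -(1 / (u + 1))) ^ (1 - ξ) := by
        rw [← Real.mul_rpow hu1.le (by linarith)]
        congr 1; field_simp; ring
    _ ≤ (u + 1) ^ (1 - ξ) * (1 + (1 - ξ) * (-(1 / (u + 1)))) := by gcongr
    _ = (u + 1) ^ (1 - ξ) - (1 - ξ) / (u + 1) ^ ξ := by
        rw [Real.rpow_sub hu1, Real.rpow_one]; field_simp; ring

end Powers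

section Recursions

variable {τ T : ℕ} {X : ℕ → ℝ}

lemma le_of_succ_le_of_le_succ {B b f : ℕ → ℝ} (hτ : X τ ≤ B τ) (hb : ∀ t, 0 ≤ b t)
    (hX : ∀ t, τ ≤ t → t < T → X (t + 1) ≤ b t * X t + f t)
    (hB : ∀ t, τ ≤ t → t < T → b t * B t + f t ≤ B (t + 1)) {t : ℕ} (hτt : τ ≤ t)
    (htT : t ≤ T) : X t ≤ B t := by
  induction t, hτt using Nat.le_induction with
  | base => exact hτ
  | succ t hτt ih =>
    calc X (t + 1) ≤ b t * X t + f t := hX t hτt htT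
      _ ≤ b t * B t + f t := by
        have := hb t
        gcongr
        exact ih (Nat.le_of_succ_le htT)
      _ ≤ B (t + 1) := hB t hτt htT

lemma mul_le_mul_add_sub_of_succ_le {W b f Ψ : ℕ → ℝ} (hτT : τ ≤ T) (hX0 : ∀ t, 0 ≤ X t)
    (hW : ∀ t, 0 ≤ W t) (hWb : ∀ t, W (t + 1) * b t ≤ W t)
    (hWf : ∀ t, W (t + 1) * f t ≤ Ψ (t + 1) - Ψ t)
    (hX : ∀ t, τ ≤ t → t < T → X (t + 1) ≤ b t * X t + f t) :
    W T * X T ≤ W τ * X τ + (Ψ T - Ψ τ) := by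
  refine le_of_succ_le_of_le_succ (X := fun t => W t * X t)
    (B := fun t => W τ * X τ + (Ψ t - Ψ τ)) (b := fun _ => 1) (f := fun t => Ψ (t + 1) - Ψ t)
    (by simp) (fun _ => zero_le_one) (fun t hτt htT => ?_) (fun t _ _ => ?_) hτT le_rfl
  · calc W (t + 1) * X (t + 1) ≤ W (t + 1) * (b t * X t + f t) :=
          mul_le_mul_of_nonneg_left (hX t hτt htT) (hW _)
      _ = W (t + 1) * b t * X t + W (t + 1) * f t := by ring
      _ ≤ 1 * (W t * X t) + (Ψ (t + 1) - Ψ t) := by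
          rw [one_mul]
          exact add_le_add (mul_le_mul_of_nonneg_right (hWb t) (hX0 t)) (hWf t)
  · exact le_of_eq (by ring)

variable {c₀ : ℝ}

lemma le_natCast_add (c : ℝ) (t : ℕ) : c ≤ (t : ℝ) + c :=
  le_add_of_nonneg_left t.cast_nonneg

lemma natCast_succ_add (c : ℝ) (t : ℕ) : ((t + 1 : ℕ) : ℝ) + c = (t : ℝ) + c + 1 := by
  push_cast
  ring

lemma add_one_rpow_mul_forcing_le {u p r E : ℝ} (hu : 2 ≤ u) (hp : 0 ≤ p) (hr : p < r)
    (hE : 0 ≤ E) :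
    (u + 1) ^ p * (E * u ^ (-1 - r))
      ≤ 2 ^ p * (E / (r - p)) * ((u - 1) ^ (-(r - p)) - u ^ (-(r - p))) := by
  have hrp : 0 < r - p := sub_pos.2 hr
  have hpow : u ^ p * u ^ (-1 - r) = u ^ (-(r - p) - 1) := by
    rw [← Real.rpow_add (by linarith)]; congr 1; ring
  calc (u + 1) ^ p * (E * u ^ (-1 - r)) ≤ 2 ^ p * u ^ p * (E * u ^ (-1 - r)) := by
        gcongr; exact add_one_rpow_le (by linarith) hp
    _ = 2 ^ p * (E / (r - p)) * ((r - p) * u ^ (-(r - p) - 1)) := by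
        rw [← hpow]; field_simp
    _ ≤ _ := by gcongr; exact mul_rpow_neg_sub_one_le (by linarith) hrp.le

lemma rpow_mul_le_of_recursion {p r₁ r₂ E₁ E₂ : ℝ} (hτT : τ ≤ T) (hc₀ : 2 ≤ c₀) (hp : 0 ≤ p)
    (hr₁ : p < r₁) (hr₂ : p < r₂) (hE₁ : 0 ≤ E₁) (hE₂ : 0 ≤ E₂) (hX0 : ∀ t, 0 ≤ X t)
    (hX : ∀ t, τ ≤ t → t < T → X (t + 1) ≤ (1 - p / (t + c₀)) * X t
      + (E₁ * ((t : ℝ) + c₀) ^ (-1 - r₁) + E₂ * ((t : ℝ) + c₀) ^ (-1 - r₂))) :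
    ((T : ℝ) + c₀) ^ p * X T ≤ ((τ : ℝ) + c₀) ^ p * X τ
      + 2 ^ p * (E₁ / (r₁ - p) + E₂ / (r₂ - p)) := by
  have hκ₁ : 0 ≤ E₁ / (r₁ - p) := div_nonneg hE₁ (sub_nonneg.2 hr₁.le)
  have hκ₂ : 0 ≤ E₂ / (r₂ - p) := div_nonneg hE₂ (sub_nonneg.2 hr₂.le)
  have hshift : ∀ t : ℕ, 2 ≤ (t : ℝ) + c₀ := fun t => hc₀.trans (le_natCast_add c₀ t)
  set ψ : ℕ → ℝ := fun t => 2 ^ p * (E₁ / (r₁ - p) * ((t : ℝ) + c₀ - 1) ^ (-(r₁ - p))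
    + E₂ / (r₂ - p) * ((t : ℝ) + c₀ - 1) ^ (-(r₂ - p))) with hψ
  have hrec := mul_le_mul_add_sub_of_succ_le (Ψ := fun t => -ψ t)
    (W := fun t => ((t : ℝ) + c₀) ^ p) hτT hX0
    (fun t => Real.rpow_nonneg (zero_le_two.trans (hshift t)) p)
    (fun t => by
      rw [natCast_succ_add, mul_comm]
      exact one_sub_div_mul_add_one_rpow_le (zero_lt_two.trans_le (hshift t)) hp)
    (fun t => by
      have h₁ := add_one_rpow_mul_forcing_le (hshift t) hp hr₁ hE₁
      have h₂ := add_one_rpow_mul_forcing_le (hshift t) hp hr₂ hE₂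
      simp only [hψ, natCast_succ_add, add_sub_cancel_right]
      linarith)
    hX
  have hψT : 0 ≤ ψ T := by
    have : 0 ≤ (T : ℝ) + c₀ - 1 := by linarith [hshift T]
    positivity
  have hψτ : ψ τ ≤ 2 ^ p * (E₁ / (r₁ - p) + E₂ / (r₂ - p)) := by
    have hbase : 1 ≤ (τ : ℝ) + c₀ - 1 := by linarith [hshift τ]
    simp only [hψ]
    gcongr
    · exact mul_le_of_le_one_right hκ₁
        (Real.rpow_le_one_of_one_le_of_nonpos hbase (by linarith))
    · exact mul_le_of_le_one_right hκ₂
        (Real.rpow_le_one_of_one_le_of_nonpos hbase (by linarith))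
  linarith

lemma mul_le_add_log_of_recursion {E : ℝ} (hτT : τ ≤ T) (hc₀ : 2 ≤ c₀) (hE : 0 ≤ E)
    (hX0 : ∀ t, 0 ≤ X t)
    (hX : ∀ t, τ ≤ t → t < T →
      X (t + 1) ≤ (1 - 1 / (t + c₀)) * X t + E / ((t : ℝ) + c₀) ^ 2) :
    ((T : ℝ) + c₀) * X T ≤ ((τ : ℝ) + c₀) * X τ + 2 * E * Real.log (T + c₀) := by
  have hshift : ∀ t : ℕ, 2 ≤ (t : ℝ) + c₀ := fun t => hc₀.trans (le_natCast_add c₀ t)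
  have hrec := mul_le_mul_add_sub_of_succ_le
    (Ψ := fun t => 2 * E * Real.log ((t : ℝ) + c₀ - 1)) (W := fun t => (t : ℝ) + c₀) hτT hX0
    (fun t => zero_le_two.trans (hshift t))
    (fun t => by
      have hpow := one_sub_div_mul_add_one_rpow_le (zero_lt_two.trans_le (hshift t)) zero_le_one
      rwa [Real.rpow_one, Real.rpow_one, ← natCast_succ_add, mul_comm] at hpow)
    (fun t => by
      have hlog := one_div_le_log_sub_log (one_lt_two.trans_le (hshift t))
      have hu := hshift t
      rw [natCast_succ_add, add_sub_cancel_right, ← mul_sub]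
      generalize (t : ℝ) + c₀ = u at *
      calc (u + 1) * (E / u ^ 2) ≤ (2 * u) * (E / u ^ 2) := by gcongr; linarith
        _ = 2 * E * (1 / u) := by field_simp
        _ ≤ _ := by gcongr)
    hX
  have hlogτ : 0 ≤ Real.log ((τ : ℝ) + c₀ - 1) := Real.log_nonneg (by linarith [hshift τ])
  have hlogT : Real.log ((T : ℝ) + c₀ - 1) ≤ Real.log (T + c₀) :=
    Real.log_le_log (by linarith [hshift T]) (by linarith)
  nlinarith

lemma le_div_of_recursion {q V E : ℝ} (hτT : τ ≤ T) (hc₀ : 0 < c₀) (hV : 0 ≤ V)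
    (hq : ∀ t : ℕ, 0 ≤ 1 - q / (t + c₀)) (hEV : E ≤ (q - 1) * V) (hτ : X τ ≤ V / (τ + c₀))
    (hX : ∀ t, τ ≤ t → t < T →
      X (t + 1) ≤ (1 - q / (t + c₀)) * X t + E / ((t : ℝ) + c₀) ^ 2) :
    X T ≤ V / (T + c₀) := by
  refine le_of_succ_le_of_le_succ (B := fun t => V / (t + c₀)) hτ hq hX (fun t _ _ => ?_) hτT
    le_rfl
  have hu : 0 < (t : ℝ) + c₀ := hc₀.trans_le (le_natCast_add c₀ t)
  rw [natCast_succ_add]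
  generalize (t : ℝ) + c₀ = u at *
  calc (1 - q / u) * (V / u) + E / u ^ 2
      ≤ (1 - q / u) * (V / u) + (q - 1) * V / u ^ 2 := by gcongr
    _ = V / (u + 1) - V / (u ^ 2 * (u + 1)) := by field_simp; ring
    _ ≤ V / (u + 1) := sub_le_self _ (by positivity)

end Recursions

/-- The coupled recursion obeyed from time `τ` to time `T` by the mean squared errors `X` of the
policy parameter and `Y` of the mean estimate, for step sizes `α` and `ρ * α`. -/
structure ErrorRecursion (α X Y : ℕ → ℝ) (ρ x₀ c₁ c₂ G H : ℝ) (τ T : ℕ) : Prop where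
  nonneg_X : ∀ t, 0 ≤ X t
  nonneg_Y : ∀ t, 0 ≤ Y t
  X_le : ∀ t, X t ≤ x₀
  Y_le : ∀ t, Y t ≤ 4
  succ_X : ∀ t, τ ≤ t → t < T →
    X (t + 1) ≤ (1 - 2 * α t * c₁) * X t + α t * c₂ * Y t + G * α t ^ 2
  succ_Y : ∀ t, τ ≤ t → t < T →
    Y (t + 1) ≤ (1 - 2 * (ρ * α t)) * Y t + H * (ρ * α t) ^ 2

section TwoTimescale

variable {c a a' e e' ρ m M κ : ℝ}

lemma one_sub_mul_exp_neg_le (hc : 0 ≤ c) (he : e' ≤ e + a) :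
    (1 - c * a) * Real.exp (-(c * e)) ≤ Real.exp (-(c * e')) := by
  calc (1 - c * a) * Real.exp (-(c * e)) ≤ Real.exp (-(c * a)) * Real.exp (-(c * e)) := by
        gcongr; exact Real.one_sub_le_exp_neg _
    _ = Real.exp (-(c * (e + a))) := by rw [← Real.exp_add]; congr 1; ring
    _ ≤ _ := by gcongr

lemma one_sub_two_mul_mul_add_le (hκ : 0 ≤ κ) (ha : a * (1 - c * a) ≤ a') :
    (1 - 2 * (c * a)) * (κ * a) + κ * c * a ^ 2 ≤ κ * a' := by
  calc _ = κ * (a * (1 - c * a)) := by ring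
    _ ≤ κ * a' := by gcongr

/-- Each step moves at most `e' - e + ρ * a ^ 2` of the mean-estimate error into the
policy-parameter error, and both then decay at the slower of the two rates. -/
lemma mixed_exp_step_le (hm : 0 ≤ m) (hmc : m ≤ c) (hmρ : m ≤ 2 * ρ) (hc : 0 ≤ c)
    (ha : 0 ≤ a) (haM : a ≤ M) (he : 0 ≤ e) (hee' : e ≤ e') (he' : e' ≤ e + a)
    (hae : a * (1 - ρ * a) ≤ e' - e) :
    (1 - 2 * a * c) * (Real.exp (c * M) * e * Real.exp (-(m * e)))
        + a * Real.exp (-(2 * ρ * e))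
      ≤ Real.exp (c * M) * e' * Real.exp (-(m * e')) + ρ * a ^ 2 := by
  have hca : 0 ≤ c * a := mul_nonneg hc ha
  have hma : m * a ≤ c * a := mul_le_mul_of_nonneg_right hmc ha
  have hcontract : (1 - 2 * a * c) * Real.exp (-(m * e)) ≤ Real.exp (-(m * e')) := by
    refine le_trans ?_ (one_sub_mul_exp_neg_le hm he')
    exact mul_le_mul_of_nonneg_right (by linarith) (Real.exp_pos _).le
  have hfresh : Real.exp (-(m * e)) ≤ Real.exp (c * M) * Real.exp (-(m * e')) := by
    rw [← Real.exp_add, Real.exp_le_exp]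
    nlinarith
  have hmoved : a * Real.exp (-(2 * ρ * e)) ≤ (e' - e) * Real.exp (-(m * e)) + ρ * a ^ 2 := by
    have hle : Real.exp (-(m * e)) ≤ 1 := Real.exp_le_one_iff.2 (by nlinarith)
    have hρ : 0 ≤ ρ := by linarith
    calc a * Real.exp (-(2 * ρ * e)) ≤ a * Real.exp (-(m * e)) := by gcongr
      _ = (a * (1 - ρ * a)) * Real.exp (-(m * e)) + ρ * a ^ 2 * Real.exp (-(m * e)) := by ring
      _ ≤ (e' - e) * Real.exp (-(m * e)) + ρ * a ^ 2 := by
          exact add_le_add (mul_le_mul_of_nonneg_right hae (Real.exp_pos _).le)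
            (mul_le_of_le_one_right (mul_nonneg hρ (sq_nonneg a)) hle)
  calc _ ≤ Real.exp (c * M) * e * ((1 - 2 * a * c) * Real.exp (-(m * e)))
        + ((e' - e) * Real.exp (-(m * e)) + ρ * a ^ 2) := by linarith
    _ ≤ Real.exp (c * M) * e * Real.exp (-(m * e'))
        + ((e' - e) * (Real.exp (c * M) * Real.exp (-(m * e'))) + ρ * a ^ 2) := by gcongr
    _ = _ := by ring

variable {α X Y S : ℕ → ℝ} {x₀ c₁ c₂ G H : ℝ} {τ T : ℕ}

namespace ErrorRecursion

variable (h : ErrorRecursion α X Y ρ x₀ c₁ c₂ G H τ T) (hα : ∀ t, 0 ≤ α t) (hSτ : S τ = 0)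
  (hS : ∀ t, S (t + 1) ≤ S t + α t) (hρ : 0 ≤ ρ)
  (hαρ : ∀ t, α t * (1 - ρ * α t) ≤ α (t + 1)) (hbρ : ∀ t, 0 ≤ 1 - 2 * (ρ * α t)) (hH : 0 ≤ H)

include h hα hSτ hS hρ hαρ hbρ hH

lemma Y_le_exp_add {t : ℕ} (hτt : τ ≤ t) (htT : t ≤ T) :
    Y t ≤ 4 * Real.exp (-(2 * ρ * S t)) + H * ρ * α t := by
  have hHρ : 0 ≤ H * ρ := mul_nonneg hH hρ
  refine le_of_succ_le_of_le_succ (B := fun t => 4 * Real.exp (-(2 * ρ * S t)) + H * ρ * α t)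
    ?_ hbρ h.succ_Y (fun t _ _ => ?_) hτt htT
  · rw [hSτ, mul_zero, neg_zero, Real.exp_zero, mul_one]
    exact (h.Y_le τ).trans (le_add_of_nonneg_right (mul_nonneg hHρ (hα τ)))
  · have hexp := one_sub_mul_exp_neg_le (mul_nonneg zero_le_two hρ) (hS t)
    have hstep := one_sub_two_mul_mul_add_le hHρ (hαρ t)
    linarith

/-- The solution for slowly decreasing step sizes, `S` being a running total of them: the initial
error decays at rate `c₁`, the forcing contributes in proportion to the current step size, and the
initial error of the mean estimate enters through a convolution of two exponentials. -/
lemma X_le_of_runningTotal (hτT : τ ≤ T) {M : ℝ} (hαM : ∀ t, α t ≤ M)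
    (hS' : ∀ t, S t + α (t + 1) ≤ S (t + 1)) (hc₁ : 0 < c₁) (hc₂ : 0 ≤ c₂) (hG : 0 ≤ G)
    (hαc : ∀ t, α t * (1 - c₁ * α t) ≤ α (t + 1)) (hbc : ∀ t, 0 ≤ 1 - 2 * α t * c₁) :
    X T ≤ x₀ * Real.exp (-(c₁ * S T)) + (G + ρ * c₂ * (H + 4)) / c₁ * α T
      + 4 * c₂ * (Real.exp (c₁ * M) * S T * Real.exp (-(min c₁ (2 * ρ) * S T))) := by
  set κ := (G + ρ * c₂ * (H + 4)) / c₁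
  have hκ0 : 0 ≤ κ := by positivity
  have hκc : κ * c₁ = G + ρ * c₂ * (H + 4) := div_mul_cancel₀ _ hc₁.ne'
  have hx₀ : 0 ≤ x₀ := (h.nonneg_X τ).trans (h.X_le τ)
  have hmono : ∀ t, S t ≤ S (t + 1) := fun t => by linarith [hS' t, hα (t + 1)]
  have hS0 : ∀ t, τ ≤ t → 0 ≤ S t := fun t ht => hSτ ▸ monotone_nat_of_le_succ hmono ht
  refine le_of_succ_le_of_le_succ (B := fun t => x₀ * Real.exp (-(c₁ * S t)) + κ * α t
      + 4 * c₂ * (Real.exp (c₁ * M) * S t * Real.exp (-(min c₁ (2 * ρ) * S t))))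
    (f := fun t => α t * c₂ * Y t + G * α t ^ 2) ?_ hbc
    (fun t hτt htT => (h.succ_X t hτt htT).trans_eq (add_assoc _ _ _))
    (fun t hτt htT => ?_) hτT le_rfl
  · simp only [hSτ, mul_zero, neg_zero, Real.exp_zero, mul_one, add_zero]
    exact (h.X_le τ).trans (le_add_of_nonneg_right (mul_nonneg hκ0 (hα τ)))
  · have hY := mul_le_mul_of_nonneg_left
      (h.Y_le_exp_add hα hSτ hS hρ hαρ hbρ hH hτt htT.le) (mul_nonneg (hα t) hc₂)
    have hinit : (1 - 2 * α t * c₁) * (x₀ * Real.exp (-(c₁ * S t)))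
        ≤ x₀ * Real.exp (-(c₁ * S (t + 1))) := by
      rw [mul_left_comm]
      refine mul_le_mul_of_nonneg_left ?_ hx₀
      refine le_trans ?_ (one_sub_mul_exp_neg_le hc₁.le (hS t))
      exact mul_le_mul_of_nonneg_right (by linarith [mul_nonneg (hα t) hc₁.le])
        (Real.exp_pos _).le
    have hforcing := one_sub_two_mul_mul_add_le hκ0 (hαc t)
    have hmixed := mixed_exp_step_le (M := M) (le_min hc₁.le (mul_nonneg zero_le_two hρ))
      (min_le_left _ _) (min_le_right _ _) hc₁.le (hα t) (hαM t) (hS0 t hτt) (hmono t) (hS t)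
      (by linarith [hαρ t, hS' t])
    rw [hκc] at hforcing
    nlinarith [mul_le_mul_of_nonneg_left hmixed hc₂]

end ErrorRecursion

end TwoTimescale

/-- Requirements on the shift `c₀` of the step sizes: the step sizes are small, and the chain mixes
to the precision of the step size within half of the shifted time. -/
structure IsThreshold (a ρ₀ ξ C b c : ℝ) : Prop where
  two_le : 2 ≤ c
  le : a ≤ c
  div_rpow_le : ∀ u, c ≤ u → a / u ^ ξ ≤ 1 / 6
  mixing_le : ∀ u, c ≤ u → L₁ C b * (1 + ξ * Real.log u - Real.log (ρ₀ * a)) ≤ u / 2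

lemma exists_isThreshold {a ρ₀ ξ C b : ℝ} (hξ : 0 < ξ) :
    ∃ c, IsThreshold a ρ₀ ξ C b c := by
  have hstep : ∀ᶠ u : ℝ in Filter.atTop, a / u ^ ξ ≤ 1 / 6 :=
    ((tendsto_rpow_atTop hξ).const_div_atTop a).eventually (ge_mem_nhds (by norm_num))
  have hmixing : ∀ᶠ u : ℝ in Filter.atTop,
      L₁ C b * (1 + ξ * Real.log u - Real.log (ρ₀ * a)) ≤ u / 2 := by
    have hlog : (fun u : ℝ => L₁ C b * ξ * Real.log u) =o[Filter.atTop] (id : ℝ → ℝ) :=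
      Real.isLittleO_log_id_atTop.const_mul_left _
    have hconst : (fun _ : ℝ => L₁ C b * (1 - Real.log (ρ₀ * a))) =o[Filter.atTop] (id : ℝ → ℝ) :=
      Asymptotics.isLittleO_const_id_atTop _
    filter_upwards [(hlog.add hconst).def (show (0 : ℝ) < 1 / 2 by norm_num),
      Filter.eventually_ge_atTop 0] with u hu hu0
    rw [Real.norm_eq_abs, id, Real.norm_of_nonneg hu0] at hu
    linarith [le_abs_self (L₁ C b * ξ * Real.log u + L₁ C b * (1 - Real.log (ρ₀ * a)))]
  obtain ⟨c, hc⟩ := Filter.eventually_atTop.1 (hstep.and hmixing)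
  have hmax : c ≤ max c (max 2 a) := le_max_left _ _
  exact ⟨max c (max 2 a), le_max_of_le_right (le_max_left 2 a),
    le_max_of_le_right (le_max_right 2 a), fun u hu => (hc u (hmax.trans hu)).1,
    fun u hu => (hc u (hmax.trans hu)).2⟩

/-- `L₁ (log (T + c₀) - log (c a) + 1)`, a bound on the time the chain needs to mix to precision
`c α_t` for `t ≤ T`. -/
noncomputable def mixingBound (a c₀ C b c : ℝ) (T : ℕ) : ℝ :=
  L₁ C b * (Real.log ((T : ℝ) + c₀) - Real.log (c * a) + 1)

lemma G₁_eq_mixingBound (a c₀ ρ₀ C b rmax Rθ : ℝ) (T : ℕ) :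
    G₁ a c₀ ρ₀ C b rmax Rθ T
      = (4 * (28 + 8 * ρ₀) * mixingBound a c₀ C b 1 T + 4) * (rmax + 3 * Rθ) ^ 2 := by
  rw [G₁, mixingBound, one_mul, mul_assoc _ (L₁ C b)]

lemma G₂_eq_mixingBound (a c₀ ρ₀ C b : ℝ) (T : ℕ) :
    G₂ a c₀ ρ₀ C b T = 64 * mixingBound a c₀ C b ρ₀ T + 12 := by
  rw [G₂, mixingBound, mul_assoc]

namespace IsThreshold

variable {a ρ₀ ξ C b c₀ : ℝ}

lemma mono {c : ℝ} (h : IsThreshold a ρ₀ ξ C b c) (hc : c ≤ c₀) : IsThreshold a ρ₀ ξ C b c₀ :=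
  ⟨h.two_le.trans hc, h.le.trans hc, fun u hu => h.div_rpow_le u (hc.trans hu),
    fun u hu => h.mixing_le u (hc.trans hu)⟩

variable (h : IsThreshold a ρ₀ ξ C b c₀)

include h

lemma two_le_shift (t : ℕ) : 2 ≤ (t : ℝ) + c₀ := h.two_le.trans (le_natCast_add c₀ t)

lemma shift_pos (t : ℕ) : 0 < (t : ℝ) + c₀ := two_pos.trans_le (h.two_le_shift t)

lemma one_le_shift (t : ℕ) : 1 ≤ (t : ℝ) + c₀ := one_le_two.trans (h.two_le_shift t)

lemma step_le (t : ℕ) : step a c₀ ξ t ≤ 1 / 6 := h.div_rpow_le _ (le_natCast_add c₀ t)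

variable (ha : 0 < a)

include ha

lemma step_pos (t : ℕ) : 0 < step a c₀ ξ t :=
  div_pos ha (Real.rpow_pos_of_pos (h.shift_pos t) _)

lemma step_antitone (hξ : 0 ≤ ξ) : Antitone (step a c₀ ξ) := by
  intro i j hij
  unfold step
  have := h.shift_pos i
  gcongr

lemma one_le_mixingBound {c : ℝ} (hc : 0 < c) (hc1 : c ≤ 1) (T : ℕ) :
    1 ≤ mixingBound a c₀ C b c T := by
  have hca : c * a ≤ (T : ℝ) + c₀ :=
    (mul_le_of_le_one_left ha.le hc1).trans (h.le.trans (le_natCast_add c₀ T))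
  have hlog : Real.log (c * a) ≤ Real.log ((T : ℝ) + c₀) :=
    Real.log_le_log (mul_pos hc ha) hca
  exact one_le_mul_of_one_le_of_one_le (one_le_L₁ C b) (by linarith)

lemma G₁_nonneg (hρ : 0 ≤ ρ₀) (rmax Rθ : ℝ) (T : ℕ) : 0 ≤ G₁ a c₀ ρ₀ C b rmax Rθ T := by
  have := h.one_le_mixingBound ha one_pos le_rfl T
  rw [G₁_eq_mixingBound]
  positivity

lemma four_le_G₂ (hρ : 0 < ρ₀) (hρ1 : ρ₀ ≤ 1) (T : ℕ) : 4 ≤ G₂ a c₀ ρ₀ C b T := by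
  rw [G₂_eq_mixingBound]
  linarith [h.one_le_mixingBound ha hρ hρ1 T]

lemma step_le_two_mul (hξ : 0 < ξ) (hξ1 : ξ ≤ 1) {n k : ℕ}
    (hk : (k : ℝ) ≤ (((n + k : ℕ) : ℝ) + c₀) / 2) :
    step a c₀ ξ n ≤ 2 * step a c₀ ξ (n + k) := by
  have hn := h.shift_pos n
  have hnk := h.shift_pos (n + k)
  have hrpow : (((n + k : ℕ) : ℝ) + c₀) ^ ξ ≤ 2 * ((n : ℝ) + c₀) ^ ξ := by
    calc (((n + k : ℕ) : ℝ) + c₀) ^ ξ ≤ (2 * ((n : ℝ) + c₀)) ^ ξ := by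
          gcongr
          push_cast at hk ⊢
          linarith
      _ = 2 ^ ξ * ((n : ℝ) + c₀) ^ ξ := Real.mul_rpow zero_le_two hn.le
      _ ≤ 2 ^ (1 : ℝ) * ((n : ℝ) + c₀) ^ ξ := by gcongr; exact one_le_two
      _ = _ := by rw [Real.rpow_one]
  rw [step, step, ← mul_div_assoc, div_le_div_iff₀ (by positivity) (by positivity)]
  nlinarith

lemma mul_step_le_exp_neg_one {c : ℝ} (hc1 : c ≤ 1) (t : ℕ) :
    c * step a c₀ ξ t ≤ Real.exp (-1) := by
  have hle := mul_le_of_le_one_left (h.step_pos ha t).le hc1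
  linarith [h.step_le t, Real.exp_neg_one_gt_d9]

variable {S : Type*} [Fintype S] [DecidableEq S] {P : Matrix S S ℝ} {μ : S → ℝ}
  (hmix : ∀ (k : ℕ) (s : S), mixDist P μ k s ≤ C * b ^ k) (hC : 1 ≤ C) (hb0 : 0 ≤ b)
  (hb1 : b < 1)

include hmix hC hb0 hb1

lemma mixingTime_mul_step_le {c : ℝ} (hc : 0 < c) (hc1 : c ≤ 1) (t : ℕ) :
    (mixingTime P μ (c * step a c₀ ξ t) : ℝ)
      ≤ L₁ C b * (1 + ξ * Real.log ((t : ℝ) + c₀) - Real.log (c * a)) := by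
  have hu := h.shift_pos t
  have hlog : Real.log (c * step a c₀ ξ t)
      = Real.log (c * a) - ξ * Real.log ((t : ℝ) + c₀) := by
    rw [step, ← mul_div_assoc, Real.log_div (by positivity) (by positivity), Real.log_rpow hu]
  refine (mixingTime_le hmix hC hb0 hb1 (mul_pos hc (h.step_pos ha t))
    (h.mul_step_le_exp_neg_one ha hc1 t)).trans_eq ?_
  rw [hlog]
  ring

/-- Looking back over the mixing time makes the current state nearly stationary given the past,
while the step sizes vary by a factor of two at most. -/
lemma exists_lag (hξ : 0 < ξ) (hξ1 : ξ ≤ 1) (hρ : 0 < ρ₀) {c : ℝ} (hρc : ρ₀ ≤ c) (hc1 : c ≤ 1)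
    {τ t T : ℕ} (hτ : mixingTime P μ (ρ₀ * step a c₀ ξ T) ≤ τ) (hτt : τ ≤ t) (htT : t ≤ T) :
    ∃ n k, n + k = t ∧ step a c₀ ξ n ≤ 2 * step a c₀ ξ (n + k) ∧
      (∀ y, mixDist P μ k y ≤ c * step a c₀ ξ (n + k)) ∧
      (k : ℝ) ≤ mixingBound a c₀ C b c T := by
  have hc : 0 < c := hρ.trans_le hρc
  have hL : 0 ≤ L₁ C b := zero_le_one.trans (one_le_L₁ C b)
  have hmixed := mixDist_mixingTime_le hmix hC hb0 hb1 (mul_pos hc (h.step_pos ha t))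
    (h.mul_step_le_exp_neg_one ha hc1 t)
  have hk := h.mixingTime_mul_step_le ha hmix hC hb0 hb1 hc hc1 t
  have hkt : mixingTime P μ (c * step a c₀ ξ t) ≤ t := by
    refine ((mixingTime_anti hmix hC hb0 hb1 (mul_pos hρ (h.step_pos ha T))
      (h.mul_step_le_exp_neg_one ha (hρc.trans hc1) T) ?_).trans hτ).trans hτt
    exact mul_le_mul hρc (h.step_antitone ha hξ.le htT) (h.step_pos ha T).le hc.le
  set k := mixingTime P μ (c * step a c₀ ξ t)
  obtain ⟨n, hn⟩ := Nat.exists_eq_add_of_le' hkt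
  refine ⟨n, k, hn.symm, h.step_le_two_mul ha hξ hξ1 ?_, ?_, ?_⟩
  · have hlog : Real.log (ρ₀ * a) ≤ Real.log (c * a) :=
      Real.log_le_log (mul_pos hρ ha) (by gcongr)
    rw [← hn]
    exact (hk.trans (by gcongr)).trans (h.mixing_le _ (le_natCast_add c₀ t))
  · rwa [← hn]
  · have hlog0 : 0 ≤ Real.log ((t : ℝ) + c₀) := Real.log_nonneg (h.one_le_shift t)
    have hlog : Real.log ((t : ℝ) + c₀) ≤ Real.log ((T : ℝ) + c₀) :=
      Real.log_le_log (h.shift_pos t) (by gcongr)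
    refine hk.trans (mul_le_mul_of_nonneg_left ?_ hL)
    nlinarith

end IsThreshold

lemma Model.IsRun.errorRecursion {S A : Type*} [Fintype S] [DecidableEq S] [Fintype A] {d : ℕ}
    {m : Model S A d} {μ : S → ℝ} {θstar w₀ θ₀ : EuclideanSpace ℝ (Fin d)}
    {a ρ₀ ξ C b c₀ Rw Rθ lam : ℝ}
    (h : m.IsRun (step a c₀ ξ) (fun t => ρ₀ * step a c₀ ξ t) Rw Rθ w₀ θ₀)
    (hth : IsThreshold a ρ₀ ξ C b c₀) (ha : 0 < a) (hρ : 0 < ρ₀) (hρ1 : ρ₀ ≤ 1) (hξ : 0 < ξ)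
    (hξ1 : ξ ≤ 1) (hC : 1 ≤ C) (hb0 : 0 ≤ b) (hb1 : b < 1) (hμ : IsStationaryDist m.P μ)
    (hmix : ∀ (k : ℕ) (s : S), mixDist m.P μ k s ≤ C * b ^ k) (hfix : m.IsFixedPoint μ θstar)
    (hstar : ‖θstar‖ ≤ Rθ) (hlam : 0 < lam) {Ω : Type*} [MeasurableSpace Ω] {ℙ : Measure Ω}
    [IsProbabilityMeasure ℙ] {s : ℕ → Ω → S} (hs : IsMarkovChain m.P ℙ s) {τ T : ℕ}
    (hτ : mixingTime m.P μ (ρ₀ * step a c₀ ξ T) ≤ τ) :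
    ErrorRecursion (step a c₀ ξ)
      (fun t => ∫ ω, ‖(m.iterates (step a c₀ ξ) (fun t => ρ₀ * step a c₀ ξ t) Rw Rθ
        w₀ θ₀ (fun t => s t ω) t).2 - θstar‖ ^ 2 ∂ℙ)
      (fun t => ∫ ω, ‖(m.iterates (step a c₀ ξ) (fun t => ρ₀ * step a c₀ ξ t) Rw Rθ
        w₀ θ₀ (fun t => s t ω) t).1 - m.wStar μ‖ ^ 2 ∂ℙ)
      ρ₀ (4 * Rθ ^ 2) (c₁ (m.eta μ) m.rMax Rθ lam) (c₂ m.rMax Rθ lam)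
      (G₁ a c₀ ρ₀ C b m.rMax Rθ T) (G₂ a c₀ ρ₀ C b T - 4) τ T where
  nonneg_X t := integral_nonneg fun _ => sq_nonneg _
  nonneg_Y t := integral_nonneg fun _ => sq_nonneg _
  X_le := h.integral_norm_snd_sub_sq_le hs hstar
  Y_le := h.integral_norm_fst_sub_sq_le hμ hs
  succ_X t hτt htT := by
    obtain ⟨n, k, rfl, hα, hD, hk⟩ := hth.exists_lag ha hmix hC hb0 hb1 hξ hξ1 hρ hρ1 le_rfl hτ
      hτt htT.le
    have hβ : ρ₀ * step a c₀ ξ n ≤ 2 * (ρ₀ * step a c₀ ξ (n + k)) := by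
      rw [mul_left_comm]
      gcongr
    simp only [one_mul] at hD
    refine (h.integral_snd_succ_le hμ hs hfix hstar hlam hα hβ hD).trans (add_le_add_right ?_ _)
    rw [G₁_eq_mixingBound, mul_right_comm (_ + 4)]
    refine mul_le_mul_of_nonneg_right ?_ (sq_nonneg _)
    have hcoeff : (48 + 32 * ρ₀) * k + 8 ≤ 4 * (28 + 8 * ρ₀) * mixingBound a c₀ C b 1 T + 4 := by
      have hle : (48 + 32 * ρ₀) * k ≤ (48 + 32 * ρ₀) * mixingBound a c₀ C b 1 T := by gcongr
      linarith [hth.one_le_mixingBound ha one_pos le_rfl T]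
    calc _ = ((48 + 32 * ρ₀) * k + 8) * step a c₀ ξ (n + k) ^ 2 := by ring
      _ ≤ _ := by gcongr
  succ_Y t hτt htT := by
    obtain ⟨n, k, rfl, hα, hD, hk⟩ := hth.exists_lag ha hmix hC hb0 hb1 hξ hξ1 hρ le_rfl hρ1 hτ
      hτt htT.le
    have hβ : ρ₀ * step a c₀ ξ n ≤ 2 * (ρ₀ * step a c₀ ξ (n + k)) := by
      rw [mul_left_comm]
      gcongr
    refine (h.integral_fst_succ_le hμ hs hβ hD).trans (add_le_add_right ?_ _)
    rw [G₂_eq_mixingBound]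
    gcongr
    linarith [hth.one_le_mixingBound ha hρ hρ1 T]

section StepSums

variable {a c c₀ ξ : ℝ} {τ t : ℕ}

lemma step_mul_one_sub_le (ha : 0 < a) (hc : 0 < c) (hc₀ : 1 ≤ c₀) (hξ : 0 ≤ ξ) (hξ1 : ξ < 1)
    (hle : (ξ / (a * c)) ^ (1 / (1 - ξ)) ≤ c₀) :
    step a c₀ ξ t * (1 - c * step a c₀ ξ t) ≤ step a c₀ ξ (t + 1) := by
  have hu1 : 1 ≤ (t : ℝ) + c₀ := hc₀.trans (le_natCast_add c₀ t)
  have hu : 0 < (t : ℝ) + c₀ := one_pos.trans_le hu1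
  have hξ' : 0 < 1 - ξ := sub_pos.2 hξ1
  have hratio : ξ / (a * c) ≤ ((t : ℝ) + c₀) ^ (1 - ξ) := by
    calc ξ / (a * c) = ((ξ / (a * c)) ^ (1 / (1 - ξ))) ^ (1 - ξ) := by
          rw [← Real.rpow_mul (by positivity), one_div_mul_cancel hξ'.ne', Real.rpow_one]
      _ ≤ ((t : ℝ) + c₀) ^ (1 - ξ) := by
          gcongr
          exact hle.trans (le_natCast_add c₀ t)
  rw [Real.rpow_sub hu, Real.rpow_one, div_le_div_iff₀ (by positivity) (by positivity)] at hratio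
  have hdecay : ξ / ((t : ℝ) + c₀) ≤ c * step a c₀ ξ t := by
    rw [step, ← mul_div_assoc, div_le_div_iff₀ hu (by positivity)]
    linarith
  calc step a c₀ ξ t * (1 - c * step a c₀ ξ t)
      ≤ a / ((t : ℝ) + c₀) ^ ξ * (1 - ξ / ((t : ℝ) + c₀)) := by
        rw [step] at hdecay ⊢
        gcongr
    _ ≤ a / ((t : ℝ) + c₀ + 1) ^ ξ := div_rpow_mul_one_sub_le hu1 hξ hξ1.le ha.le
    _ = step a c₀ ξ (t + 1) := by rw [step, natCast_succ_add]

lemma Δ_succ (c₀ ξ : ℝ) (τ t : ℕ) :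
    Δ c₀ ξ τ (t + 1)
      = Δ c₀ ξ τ t + (((t : ℝ) + c₀ + 1) ^ (1 - ξ) - ((t : ℝ) + c₀) ^ (1 - ξ)) := by
  rw [Δ, Δ, natCast_succ_add]
  ring

lemma mul_Δ_succ_le (ha : 0 ≤ a) (hc₀ : 1 ≤ c₀) (hξ : 0 ≤ ξ) (hξ1 : ξ < 1) :
    a / (1 - ξ) * Δ c₀ ξ τ (t + 1) ≤ a / (1 - ξ) * Δ c₀ ξ τ t + step a c₀ ξ t := by
  have hξ' : 0 < 1 - ξ := sub_pos.2 hξ1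
  rw [Δ_succ, mul_add]
  gcongr
  calc _ ≤ a / (1 - ξ) * ((1 - ξ) / ((t : ℝ) + c₀) ^ ξ) := by
        gcongr
        exact add_one_rpow_one_sub_sub_le (hc₀.trans (le_natCast_add c₀ t)) hξ hξ1.le
    _ = step a c₀ ξ t := by rw [step, div_mul_div_cancel₀ hξ'.ne']

lemma mul_Δ_add_step_succ_le (ha : 0 ≤ a) (hc₀ : 0 ≤ c₀) (hξ : 0 ≤ ξ) (hξ1 : ξ < 1) :
    a / (1 - ξ) * Δ c₀ ξ τ t + step a c₀ ξ (t + 1) ≤ a / (1 - ξ) * Δ c₀ ξ τ (t + 1) := by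
  have hξ' : 0 < 1 - ξ := sub_pos.2 hξ1
  rw [Δ_succ, mul_add]
  gcongr
  calc step a c₀ ξ (t + 1) = a / (1 - ξ) * ((1 - ξ) / ((t : ℝ) + c₀ + 1) ^ ξ) := by
        rw [step, natCast_succ_add, div_mul_div_cancel₀ hξ'.ne']
    _ ≤ _ := by
        gcongr
        exact le_add_one_rpow_one_sub_sub (by positivity) hξ hξ1.le

end StepSums

namespace ErrorRecursion

variable {a ρ₀ ξ C b c₀ x₀ c1 c2 G1 G2 : ℝ} {X Y : ℕ → ℝ} {τ T : ℕ}

lemma le_of_lt_one (h : ErrorRecursion (step a c₀ ξ) X Y ρ₀ x₀ c1 c2 G1 (G2 - 4) τ T)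
    (hth : IsThreshold a ρ₀ ξ C b c₀) (ha : 0 < a) (hρ : 0 < ρ₀) (hρ1 : ρ₀ ≤ 1) (hξ : 0 ≤ ξ)
    (hξ1 : ξ < 1) (hτT : τ ≤ T) (hc1 : 0 < c1) (hc1_le : c1 ≤ 3) (hc2 : 0 ≤ c2) (hG1 : 0 ≤ G1)
    (hG2 : 4 ≤ G2)
    (hc₀ : max ((ξ / (a * c1)) ^ (1 / (1 - ξ))) ((ξ / (ρ₀ * a)) ^ (1 / (1 - ξ))) ≤ c₀) :
    X T ≤ x₀ * Real.exp (-(a * c1 / (1 - ξ)) * Δ c₀ ξ τ T)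
      + a * (G1 + ρ₀ * c2 * G2) / (c1 * ((T : ℝ) + c₀) ^ ξ)
      + 4 * a * c2 / (1 - ξ) * Real.exp (a * c1 / c₀ ^ ξ) * Δ c₀ ξ τ T
          * Real.exp (-(a / (1 - ξ)) * min c1 (2 * ρ₀) * Δ c₀ ξ τ T) := by
  have hc₀1 : 1 ≤ c₀ := one_le_two.trans hth.two_le
  have hc₀0 : 0 < c₀ := one_pos.trans_le hc₀1
  obtain ⟨hc₀c1, hc₀ρ⟩ := max_le_iff.1 hc₀
  rw [mul_comm ρ₀ a] at hc₀ρ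
  have hsmall : ∀ {c : ℝ}, c ≤ 3 → ∀ t, c * step a c₀ ξ t ≤ 1 / 2 := fun hc t => by
    nlinarith [hth.step_le t, hth.step_pos ha t]
  have hαM : ∀ t, step a c₀ ξ t ≤ a / c₀ ^ ξ := fun t => by
    rw [step]
    gcongr
    exact le_natCast_add c₀ t
  have hbound := h.X_le_of_runningTotal (S := fun t => a / (1 - ξ) * Δ c₀ ξ τ t)
    (fun t => (hth.step_pos ha t).le) (by simp only [Δ, sub_self, mul_zero])
    (fun t => mul_Δ_succ_le ha.le hc₀1 hξ hξ1) hρ.le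
    (fun t => step_mul_one_sub_le ha hρ hc₀1 hξ hξ1 hc₀ρ)
    (fun t => by linarith [hsmall (hρ1.trans (by norm_num)) t]) (sub_nonneg.2 hG2) hτT hαM
    (fun t => mul_Δ_add_step_succ_le ha.le hc₀0.le hξ hξ1) hc1 hc2 hG1
    (fun t => step_mul_one_sub_le ha hc1 hc₀1 hξ hξ1 hc₀c1)
    (fun t => by linarith [hsmall hc1_le t])
  rw [sub_add_cancel] at hbound
  convert hbound using 2
  · congr 1
    · congr 2; ring
    · rw [step, div_mul_div_comm, mul_comm a]
  · rw [show c1 * (a / c₀ ^ ξ) = a * c1 / c₀ ^ ξ by ring,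
      show -(a / (1 - ξ)) * min c1 (2 * ρ₀) * Δ c₀ ξ τ T
        = -(min c1 (2 * ρ₀) * (a / (1 - ξ) * Δ c₀ ξ τ T)) by ring]
    ring

end ErrorRecursion

lemma rpow_neg_one_sub_one {u : ℝ} (hu : 0 ≤ u) : u ^ (-1 - (1 : ℝ)) = 1 / u ^ 2 := by
  rw [show (-1 - (1 : ℝ)) = -((2 : ℕ) : ℝ) by norm_num, Real.rpow_neg hu, Real.rpow_natCast,
    one_div]

lemma two_rpow_le_four {p : ℝ} (hp : p ≤ 1) : (2 : ℝ) ^ p ≤ 4 := by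
  calc (2 : ℝ) ^ p ≤ 2 ^ (1 : ℝ) := Real.rpow_le_rpow_of_exponent_le one_le_two hp
    _ ≤ 4 := by norm_num

namespace ErrorRecursion

variable {ρ₀ x₀ c1 c2 G H : ℝ} {X Y : ℕ → ℝ} {τ T : ℕ}

lemma mono {α : ℕ → ℝ} (h : ErrorRecursion α X Y ρ₀ x₀ c1 c2 G H τ T) {H' : ℝ} (hH : H ≤ H') :
    ErrorRecursion α X Y ρ₀ x₀ c1 c2 G H' τ T :=
  { h with
    succ_Y := fun t hτt htT => (h.succ_Y t hτt htT).trans (by gcongr) }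

variable {a c₀ : ℝ} (h : ErrorRecursion (step a c₀ 1) X Y ρ₀ x₀ c1 c2 G H τ T)

include h

section MeanEstimate

lemma succ_Y_of_one {t : ℕ} (hτt : τ ≤ t) (htT : t < T) :
    Y (t + 1) ≤ (1 - 2 * ρ₀ * a / (t + c₀)) * Y t + H * (ρ₀ * a) ^ 2 / ((t : ℝ) + c₀) ^ 2 := by
  refine (h.succ_Y t hτt htT).trans_eq ?_
  rw [step, Real.rpow_one]
  generalize (t : ℝ) + c₀ = u
  ring

variable (hc₀ : 2 ≤ c₀) (hH : 0 ≤ H) {t : ℕ} (hτt : τ ≤ t) (htT : t ≤ T)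

include hc₀ hH hτt htT

lemma rpow_mul_Y_le_of_lt (hρa : 0 ≤ ρ₀ * a) (hlt : ρ₀ * a < 1 / 2) :
    ((t : ℝ) + c₀) ^ (2 * ρ₀ * a) * Y t ≤ 4 * ((τ : ℝ) + c₀) ^ (2 * ρ₀ * a)
      + 4 * ρ₀ ^ 2 * a ^ 2 / (1 - 2 * ρ₀ * a) * H := by
  set q := 2 * ρ₀ * a
  have hq0 : 0 ≤ q := by linarith
  have hq1 : q < 1 := by linarith
  have : 0 ≤ c₀ := zero_le_two.trans hc₀
  have hbound := rpow_mul_le_of_recursion (X := Y) (E₁ := H * (ρ₀ * a) ^ 2) (E₂ := 0) hτt hc₀ hq0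
    hq1 hq1 (by positivity) le_rfl h.nonneg_Y fun i hi hit => by
      have hi0 : 0 ≤ (i : ℝ) + c₀ := by positivity
      rw [rpow_neg_one_sub_one hi0, zero_mul, add_zero, mul_one_div]
      exact h.succ_Y_of_one hi (hit.trans_le htT)
  refine hbound.trans (add_le_add ?_ ?_)
  · rw [mul_comm]
    gcongr
    exact h.Y_le τ
  · rw [zero_div, add_zero]
    calc (2 : ℝ) ^ q * (H * (ρ₀ * a) ^ 2 / (1 - q)) ≤ 4 * (H * (ρ₀ * a) ^ 2 / (1 - q)) :=
          mul_le_mul_of_nonneg_right (two_rpow_le_four hq1.le)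
            (div_nonneg (by positivity) (sub_pos.2 hq1).le)
      _ = _ := by ring

lemma mul_Y_le_of_eq (heq : ρ₀ * a = 1 / 2) :
    ((t : ℝ) + c₀) * Y t ≤ 4 * ((τ : ℝ) + c₀) ^ (2 * ρ₀ * a)
      + 4 * ρ₀ ^ 2 * a ^ 2 * Real.log ((T : ℝ) + c₀) * H := by
  have hq : 2 * ρ₀ * a = 1 := by rw [mul_assoc, heq]; norm_num
  have hc₀1 : 1 ≤ c₀ := one_le_two.trans hc₀
  have : 0 < c₀ := one_pos.trans_le hc₀1
  have hlog0 : 0 ≤ Real.log ((t : ℝ) + c₀) :=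
    Real.log_nonneg (hc₀1.trans (le_natCast_add c₀ t))
  have hlog : Real.log ((t : ℝ) + c₀) ≤ Real.log ((T : ℝ) + c₀) :=
    Real.log_le_log (by positivity) (by gcongr)
  have hbound := mul_le_add_log_of_recursion (X := Y) (E := H * (ρ₀ * a) ^ 2) hτt hc₀
    (by positivity) h.nonneg_Y
    fun i hi hit => by simpa only [hq] using h.succ_Y_of_one hi (hit.trans_le htT)
  rw [hq, Real.rpow_one]
  refine hbound.trans (add_le_add ?_ ?_)
  · rw [mul_comm]
    gcongr
    exact h.Y_le τ
  · calc 2 * (H * (ρ₀ * a) ^ 2) * Real.log ((t : ℝ) + c₀)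
        ≤ 4 * (H * (ρ₀ * a) ^ 2) * Real.log ((T : ℝ) + c₀) := by gcongr; norm_num
      _ = _ := by ring

lemma mul_Y_le_of_gt (hgt : 1 / 2 < ρ₀ * a) (hle : 2 * ρ₀ * a ≤ c₀) :
    ((t : ℝ) + c₀) * Y t ≤ 4 * ((τ : ℝ) + c₀) ^ (2 * ρ₀ * a)
      + 4 * Real.exp 1 * ρ₀ ^ 2 * a ^ 2 / (2 * ρ₀ * a - 1) * H := by
  set q := 2 * ρ₀ * a
  have hq1 : 0 < q - 1 := by linarith
  have hc₀0 : 0 < c₀ := two_pos.trans_le hc₀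
  have hτ1 : 1 ≤ (τ : ℝ) + c₀ := one_le_two.trans (hc₀.trans (le_natCast_add c₀ τ))
  have hforcing : 0 ≤ 4 * Real.exp 1 * ρ₀ ^ 2 * a ^ 2 / (q - 1) * H := by positivity
  set V := 4 * ((τ : ℝ) + c₀) ^ q + 4 * Real.exp 1 * ρ₀ ^ 2 * a ^ 2 / (q - 1) * H
  have hEV : H * (ρ₀ * a) ^ 2 ≤ (q - 1) * V := by
    calc H * (ρ₀ * a) ^ 2 ≤ 4 * Real.exp 1 * (H * (ρ₀ * a) ^ 2) :=
          le_mul_of_one_le_left (by positivity) (by linarith [Real.add_one_le_exp (1 : ℝ)])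
      _ = (q - 1) * (4 * Real.exp 1 * ρ₀ ^ 2 * a ^ 2 / (q - 1) * H) := by field_simp
      _ ≤ (q - 1) * V := by
          gcongr
          exact le_add_of_nonneg_left (by positivity)
  have hτV : Y τ ≤ V / (τ + c₀) := by
    rw [le_div_iff₀ (by positivity)]
    calc Y τ * (τ + c₀) ≤ 4 * ((τ : ℝ) + c₀) ^ q := by
          gcongr
          · exact h.Y_le τ
          · exact Real.self_le_rpow_of_one_le hτ1 (by linarith)
      _ ≤ V := le_add_of_nonneg_right hforcing
  rw [← le_div_iff₀' (by positivity)]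
  exact le_div_of_recursion hτt hc₀0 (by positivity)
    (fun i => sub_nonneg.2 (div_le_one_of_le₀ (hle.trans (le_natCast_add c₀ i)) (by positivity)))
    hEV hτV fun i hi hit => h.succ_Y_of_one hi (hit.trans_le htT)

end MeanEstimate

section PolicyParameter

variable (ha : 0 ≤ a) (hc₀ : 2 ≤ c₀) (hc1 : 0 ≤ c1) (hc2 : 0 ≤ c2)

include ha hc₀ hc1 hc2

lemma succ_X_of_decay {V r : ℝ} {t : ℕ} (hV : ((t : ℝ) + c₀) ^ r * Y t ≤ V) (hτt : τ ≤ t)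
    (htT : t < T) :
    X (t + 1) ≤ (1 - a * c1 / (t + c₀)) * X t + (a * c2 * V * ((t : ℝ) + c₀) ^ (-1 - r)
      + a ^ 2 * G * ((t : ℝ) + c₀) ^ (-1 - (1 : ℝ))) := by
  have hrec := h.succ_X t hτt htT
  have hX := h.nonneg_X t
  have hu : 0 < (t : ℝ) + c₀ := two_pos.trans_le (hc₀.trans (le_natCast_add c₀ t))
  rw [rpow_neg_one_sub_one hu.le, Real.rpow_sub hu, Real.rpow_neg_one]
  simp only [step, Real.rpow_one] at hrec
  rw [← le_div_iff₀' (Real.rpow_pos_of_pos hu r)] at hV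
  generalize (t : ℝ) + c₀ = u at *
  calc X (t + 1) ≤ (1 - 2 * (a / u) * c1) * X t + a / u * c2 * Y t + G * (a / u) ^ 2 := hrec
    _ ≤ (1 - 2 * (a / u) * c1) * X t + a / u * c2 * (V / u ^ r) + G * (a / u) ^ 2
        + a / u * c1 * X t := le_add_of_le_of_nonneg (by gcongr) (by positivity)
    _ = _ := by ring

variable (hac1 : a * c1 < 1) (hG : 0 ≤ G) (hτT : τ ≤ T)

include hac1 hG hτT

lemma X_le_of_decay {V r : ℝ} (hr : a * c1 < r)
    (hV : ∀ t : ℕ, τ ≤ t → t ≤ T → ((t : ℝ) + c₀) ^ r * Y t ≤ V) :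
    X T ≤ x₀ * (((τ : ℝ) + c₀) / ((T : ℝ) + c₀)) ^ (a * c1)
      + (2 ^ (a * c1) * (a * c2 * V / (r - a * c1)) + Γ₀ a c1 * G)
          / ((T : ℝ) + c₀) ^ (a * c1) := by
  have hτ0 : 0 ≤ (τ : ℝ) + c₀ := zero_le_two.trans (hc₀.trans (le_natCast_add c₀ τ))
  have hT0 : 0 < (T : ℝ) + c₀ := two_pos.trans_le (hc₀.trans (le_natCast_add c₀ T))
  have hV0 : 0 ≤ V :=
    (mul_nonneg (Real.rpow_nonneg hτ0 r) (h.nonneg_Y τ)).trans (hV τ le_rfl hτT)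
  have hbound := rpow_mul_le_of_recursion hτT hc₀ (mul_nonneg ha hc1) hr hac1 (by positivity)
    (by positivity) h.nonneg_X
    fun t hτt htT => h.succ_X_of_decay ha hc₀ hc1 hc2 (hV t hτt htT.le) hτt htT
  have hinit : ((τ : ℝ) + c₀) ^ (a * c1) * X τ ≤ x₀ * ((τ : ℝ) + c₀) ^ (a * c1) := by
    rw [mul_comm]
    gcongr
    exact h.X_le τ
  have hforcing : (2 : ℝ) ^ (a * c1) * (a ^ 2 * G / (1 - a * c1)) ≤ Γ₀ a c1 * G := by
    calc _ ≤ 4 * (a ^ 2 * G / (1 - a * c1)) :=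
          mul_le_mul_of_nonneg_right (two_rpow_le_four hac1.le)
            (div_nonneg (by positivity) (sub_pos.2 hac1).le)
      _ = _ := by rw [Γ₀]; ring
  rw [Real.div_rpow hτ0 hT0.le, ← mul_div_assoc, ← add_div,
    le_div_iff₀ (Real.rpow_pos_of_pos hT0 _)]
  linarith

lemma X_le_of_inv_decay {V : ℝ} (hV : ∀ t : ℕ, τ ≤ t → t ≤ T → ((t : ℝ) + c₀) * Y t ≤ V) :
    X T ≤ x₀ * (((τ : ℝ) + c₀) / ((T : ℝ) + c₀)) ^ (a * c1)
      + (4 * a * c2 / (1 - a * c1) * V + Γ₀ a c1 * G) / ((T : ℝ) + c₀) ^ (a * c1) := by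
  have hτ0 : 0 ≤ (τ : ℝ) + c₀ := zero_le_two.trans (hc₀.trans (le_natCast_add c₀ τ))
  have : 0 < (T : ℝ) + c₀ := two_pos.trans_le (hc₀.trans (le_natCast_add c₀ T))
  have hV0 : 0 ≤ V := (mul_nonneg hτ0 (h.nonneg_Y τ)).trans (hV τ le_rfl hτT)
  have : 0 < 1 - a * c1 := sub_pos.2 hac1
  have hcoeff : (2 : ℝ) ^ (a * c1) * (a * c2 * V / (1 - a * c1))
      ≤ 4 * a * c2 / (1 - a * c1) * V := by
    calc _ ≤ 4 * (a * c2 * V / (1 - a * c1)) :=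
          mul_le_mul_of_nonneg_right (two_rpow_le_four hac1.le) (by positivity)
      _ = _ := by ring
  refine (h.X_le_of_decay ha hc₀ hc1 hc2 hac1 hG hτT (V := V) hac1
    (by simpa only [Real.rpow_one] using hV)).trans ?_
  gcongr _ + (?_ + _) / _

end PolicyParameter

lemma le_of_one (ha : 0 < a) (hc₀ : 2 ≤ c₀) (hρ : 0 < ρ₀) (hle : 2 * ρ₀ * a ≤ c₀) (hτT : τ ≤ T)
    (hc1 : 0 ≤ c1) (hc1_lt : c1 < 2 * ρ₀) (hac1 : a * c1 < 1) (hc2 : 0 ≤ c2) (hG : 0 ≤ G)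
    (hH : 0 ≤ H) :
    X T ≤ x₀ * (((τ : ℝ) + c₀) / ((T : ℝ) + c₀)) ^ (a * c1)
      + (Γ₁ a c₀ ρ₀ c1 c2 H τ T + Γ₀ a c1 * G) / ((T : ℝ) + c₀) ^ (a * c1) := by
  unfold Γ₁
  split_ifs with hlt heq
  · refine (h.X_le_of_decay ha.le hc₀ hc1 hc2 hac1 hG hτT (r := 2 * ρ₀ * a) (by nlinarith)
      fun t hτt htT => h.rpow_mul_Y_le_of_lt hc₀ hH hτt htT (by positivity) hlt).trans_eq ?_
    ring
  · exact h.X_le_of_inv_decay ha.le hc₀ hc1 hc2 hac1 hG hτT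
      fun t hτt htT => h.mul_Y_le_of_eq hc₀ hH hτt htT heq
  · exact h.X_le_of_inv_decay ha.le hc₀ hc1 hc2 hac1 hG hτT
      fun t hτt htT => h.mul_Y_le_of_gt hc₀ hH hτt htT
        (lt_of_le_of_ne (not_lt.1 hlt) (Ne.symm heq)) hle

end ErrorRecursion

section Constants

variable {η rmax Rθ lam : ℝ}

lemma c₂_nonneg (hF : 0 ≤ rmax + 2 * Rθ) : 0 ≤ c₂ rmax Rθ lam := div_nonneg hF (sq_nonneg _)

lemma c₁_le (hF : 0 ≤ rmax + 2 * Rθ) : c₁ η rmax Rθ lam ≤ η :=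
  sub_le_self _ (by positivity)

lemma c₂_eq_sq_div (hlam : lam ^ 2 = η / (rmax + 2 * Rθ)) :
    c₂ rmax Rθ lam = (rmax + 2 * Rθ) ^ 2 / η := by
  rw [c₂, hlam, div_div_eq_mul_div, sq]

variable (hF : 0 < rmax + 2 * Rθ)

include hF

lemma c₁_pos_iff : 0 < c₁ η rmax Rθ lam ↔ lam ^ 2 < 2 * η / (rmax + 2 * Rθ) := by
  rw [lt_div_iff₀ hF, c₁, sub_pos, div_lt_iff₀ two_pos, mul_comm η]

lemma c₁_nonneg_iff : 0 ≤ c₁ η rmax Rθ lam ↔ lam ^ 2 ≤ 2 * η / (rmax + 2 * Rθ) := by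
  rw [le_div_iff₀ hF, c₁, sub_nonneg, div_le_iff₀ two_pos, mul_comm η]

lemma c₁_lt_two_mul_iff {ρ₀ : ℝ} :
    c₁ η rmax Rθ lam < 2 * ρ₀ ↔ (2 * η - 4 * ρ₀) / (rmax + 2 * Rθ) < lam ^ 2 := by
  rw [div_lt_iff₀ hF, c₁]
  constructor <;> intro h <;> linarith

lemma c₁_eq_half (hlam : lam ^ 2 = η / (rmax + 2 * Rθ)) : c₁ η rmax Rθ lam = η / 2 := by
  rw [c₁, hlam, div_mul_cancel₀ _ hF.ne']
  ring

end Constants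

section ConditionNumber

variable {K η η' rmax Rθ : ℝ} (hη' : 0 < η') (hη'1 : η' ≤ 1) (hr : 0 ≤ rmax) (hRθ : 0 ≤ Rθ)
  (hrK : rmax ≤ K) (hRθK : Rθ ≤ K / √η')

include hη' hη'1 hr hRθ hrK hRθK

lemma add_mul_sq_le_div {n : ℝ} (hn : 0 ≤ n) :
    (rmax + n * Rθ) ^ 2 ≤ (1 + n) ^ 2 * (K ^ 2 / η') := by
  have hrK' : rmax ≤ K / √η' :=
    hrK.trans (le_div_self (hr.trans hrK) (Real.sqrt_pos.2 hη') (Real.sqrt_le_one.2 hη'1))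
  calc (rmax + n * Rθ) ^ 2 ≤ (K / √η' + n * (K / √η')) ^ 2 := by gcongr
    _ = (1 + n) ^ 2 * (K ^ 2 / √η' ^ 2) := by ring
    _ = _ := by rw [Real.sq_sqrt hη'.le]

lemma leadingCoeff_le {a ρ₀ ℓ lam G1 G2 : ℝ} (hρ : 0 ≤ ρ₀) (hρ1 : ρ₀ ≤ 1) (hη : 0 < η)
    (hη3 : η ≤ 3) (haK : a ≤ K / η) (hF : 0 < rmax + 2 * Rθ)
    (hlam : lam ^ 2 = η / (rmax + 2 * Rθ)) (hG1 : 0 ≤ G1) (hG2 : 0 ≤ G2)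
    (hG1ℓ : G1 ≤ 148 * ℓ * (rmax + 3 * Rθ) ^ 2) (hG2ℓ : G2 ≤ 76 * ℓ) :
    a * (G1 + ρ₀ * c₂ rmax Rθ lam * G2) / c₁ η rmax Rθ lam
      ≤ 15576 * K ^ 3 * ℓ / (η' * η ^ 3) := by
  have hK : 0 ≤ K := hr.trans hrK
  have hℓ : 0 ≤ ℓ := by linarith
  have hfirst : G1 ≤ 7104 * ℓ * (K ^ 2 / η') / η := by
    rw [le_div_iff₀ hη]
    calc G1 * η ≤ 148 * ℓ * ((1 + 3) ^ 2 * (K ^ 2 / η')) * 3 := by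
          gcongr
          refine hG1ℓ.trans ?_
          gcongr
          exact add_mul_sq_le_div hη' hη'1 hr hRθ hrK hRθK zero_le_three
      _ = _ := by ring
  have hsecond : ρ₀ * c₂ rmax Rθ lam * G2 ≤ 684 * ℓ * (K ^ 2 / η') / η := by
    rw [c₂_eq_sq_div hlam]
    calc ρ₀ * ((rmax + 2 * Rθ) ^ 2 / η) * G2
        ≤ 1 * ((1 + 2) ^ 2 * (K ^ 2 / η') / η) * (76 * ℓ) := by
          gcongr
          exact add_mul_sq_le_div hη' hη'1 hr hRθ hrK hRθK zero_le_two
      _ = _ := by ring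
  have hsum : 0 ≤ G1 + ρ₀ * c₂ rmax Rθ lam * G2 := by
    have := c₂_nonneg (lam := lam) hF.le
    positivity
  rw [c₁_eq_half hF hlam]
  calc a * (G1 + ρ₀ * c₂ rmax Rθ lam * G2) / (η / 2)
      ≤ K / η * (7104 * ℓ * (K ^ 2 / η') / η + 684 * ℓ * (K ^ 2 / η') / η) / (η / 2) := by
        gcongr
    _ = _ := by field_simp; ring

end ConditionNumber

lemma mul_pow_three_div_le_mul_pow_four_div {c K η η' ℓ : ℝ} (hc : 0 ≤ c) (hK : 0 ≤ K)
    (hη : 0 < η) (hη' : 0 < η') (hℓ : 0 ≤ ℓ) (h : η ≤ K * η') :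
    c * K ^ 3 * ℓ / (η' * η ^ 3) ≤ c * K ^ 4 * ℓ / η ^ 4 := by
  rw [div_le_div_iff₀ (by positivity) (by positivity)]
  calc c * K ^ 3 * ℓ * η ^ 4 = c * K ^ 3 * ℓ * η ^ 3 * η := by ring
    _ ≤ c * K ^ 3 * ℓ * η ^ 3 * (K * η') := by gcongr
    _ = _ := by ring

lemma pos_of_le_div_sqrt {x y K : ℝ} (hx : 0 < x) (h : x ≤ K / √y) : 0 < y := by
  by_contra! hy
  rw [Real.sqrt_eq_zero_of_nonpos hy, div_zero] at h
  exact hx.not_ge h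

namespace IsThreshold

variable {a ρ₀ ξ C b c₀ : ℝ} (h : IsThreshold a ρ₀ ξ C b c₀) (ha : 0 < a) (hρ : 0 < ρ₀)
  (hρ1 : ρ₀ ≤ 1)

include h ha hρ hρ1

lemma G₁_le (rmax Rθ : ℝ) (T : ℕ) :
    G₁ a c₀ ρ₀ C b rmax Rθ T ≤ 148 * mixingBound a c₀ C b ρ₀ T * (rmax + 3 * Rθ) ^ 2 := by
  have hℓ := h.one_le_mixingBound ha hρ hρ1 T
  have hℓ₁ := h.one_le_mixingBound ha one_pos le_rfl T
  have hlog : Real.log (ρ₀ * a) ≤ Real.log (1 * a) := Real.log_le_log (by positivity) (by gcongr)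
  have hmono : mixingBound a c₀ C b 1 T ≤ mixingBound a c₀ C b ρ₀ T :=
    mul_le_mul_of_nonneg_left (by linarith) (zero_le_one.trans (one_le_L₁ C b))
  rw [G₁_eq_mixingBound]
  gcongr
  calc 4 * (28 + 8 * ρ₀) * mixingBound a c₀ C b 1 T + 4
      ≤ 4 * (28 + 8 * 1) * mixingBound a c₀ C b ρ₀ T + 4 * mixingBound a c₀ C b ρ₀ T := by
        gcongr
        linarith
    _ = _ := by ring

lemma G₂_le (T : ℕ) : G₂ a c₀ ρ₀ C b T ≤ 76 * mixingBound a c₀ C b ρ₀ T := by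
  rw [G₂_eq_mixingBound]
  linarith [h.one_le_mixingBound ha hρ hρ1 T]

lemma isRun (hξ : 0 ≤ ξ) {S A : Type*} [Fintype S] [Fintype A] {d : ℕ} {m : Model S A d}
    {w₀ θ₀ : EuclideanSpace ℝ (Fin d)} {Rw Rθ : ℝ} (hφ : ∀ s, ‖m.φ s‖ ≤ 1) (hRw : 1 ≤ Rw)
    (hw₀ : ‖w₀‖ ≤ 1) (hθ₀ : ‖θ₀‖ ≤ Rθ) :
    m.IsRun (step a c₀ ξ) (fun t => ρ₀ * step a c₀ ξ t) Rw Rθ w₀ θ₀ where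
  norm_φ_le := hφ
  α_nonneg t := (h.step_pos ha t).le
  α_antitone := h.step_antitone ha hξ
  β_nonneg t := mul_nonneg hρ.le (h.step_pos ha t).le
  β_le_one t := by nlinarith [h.step_le t, h.step_pos ha t]
  β_antitone := (h.step_antitone ha hξ).const_mul hρ.le
  one_le_Rw := hRw
  norm_w₀_le := hw₀
  norm_θ₀_le := hθ₀

end IsThreshold

lemma IsThreshold.two_mul_le {a ρ₀ C b c₀ : ℝ} (h : IsThreshold a ρ₀ 1 C b c₀) (hρ1 : ρ₀ ≤ 1)
    (ha : 0 ≤ a) : 2 * ρ₀ * a ≤ c₀ := by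
  have hstep := h.div_rpow_le c₀ le_rfl
  have hc₀ : 0 < c₀ := two_pos.trans_le h.two_le
  rw [Real.rpow_one, div_le_iff₀ hc₀] at hstep
  nlinarith

end SingleChainTD

theorem theoremt_general :
    ∃ M : ℝ, 0 < M ∧
    ∀ (a ρ₀ ξ C b : ℝ), 0 < a → 0 < ρ₀ → ρ₀ ≤ 1 → 0 < ξ → ξ ≤ 1 → 1 ≤ C → 0 ≤ b → b < 1 →
    ∃ cbar : ℝ, 0 < cbar ∧
    ∀ (S A : Type*) [Fintype S] [DecidableEq S] [Fintype A] (d : ℕ) (m : Model S A d)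
      (μ : S → ℝ) (θstar : EuclideanSpace ℝ (Fin d)) (Rw Rθ lam : ℝ),
      IsStationaryDist m.P μ →
      (∀ (k : ℕ) (s : S), mixDist m.P μ k s ≤ C * b ^ k) →
      (∀ s, ‖m.φ s‖ ≤ 1) → m.IsFixedPoint μ θstar →
      1 ≤ Rw → 0 < Rθ → ‖θstar‖ ≤ Rθ → 0 < lam →
    ∀ (c₀ : ℝ), cbar ≤ c₀ →
    ∀ (Ω : Type*) [MeasurableSpace Ω] (ℙ : Measure Ω) [IsProbabilityMeasure ℙ]
      (s : ℕ → Ω → S), IsMarkovChain m.P ℙ s →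
    ∀ (w₀ θ₀ : EuclideanSpace ℝ (Fin d)), ‖w₀‖ ≤ 1 → ‖θ₀‖ ≤ Rθ →
    ∀ (τ T : ℕ), mixingTime m.P μ (ρ₀ * step a c₀ ξ T) ≤ τ → τ ≤ T →
    ∀ (η c1 c2 G1 G2 err : ℝ), η = m.eta μ →
      c1 = c₁ η m.rMax Rθ lam → c2 = c₂ m.rMax Rθ lam →
      G1 = G₁ a c₀ ρ₀ C b m.rMax Rθ T → G2 = G₂ a c₀ ρ₀ C b T →
      err = ∫ ω, ‖(m.iterates (step a c₀ ξ) (fun t => ρ₀ * step a c₀ ξ t) Rw Rθ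
        w₀ θ₀ (fun t => s t ω) T).2 - θstar‖ ^ 2 ∂ℙ →
      (ξ < 1 → lam ^ 2 < 2 * η / (m.rMax + 2 * Rθ) →
        max ((ξ / (a * c1)) ^ (1 / (1 - ξ))) ((ξ / (ρ₀ * a)) ^ (1 / (1 - ξ))) ≤ c₀ →
        err ≤ 4 * Rθ ^ 2 * Real.exp (-(a * c1 / (1 - ξ)) * Δ c₀ ξ τ T)
          + a * (G1 + ρ₀ * c2 * G2) / (c1 * ((T : ℝ) + c₀) ^ ξ)
          + 4 * a * c2 / (1 - ξ) * Real.exp (a * c1 / c₀ ^ ξ) * Δ c₀ ξ τ T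
              * Real.exp (-(a / (1 - ξ)) * min c1 (2 * ρ₀) * Δ c₀ ξ τ T)) ∧
      (ξ = 1 → a * η < 1 → lam ^ 2 ≤ 2 * η / (m.rMax + 2 * Rθ) →
        (2 * η - 4 * ρ₀) / (m.rMax + 2 * Rθ) < lam ^ 2 →
        err ≤ 4 * Rθ ^ 2 * (((τ : ℝ) + c₀) / ((T : ℝ) + c₀)) ^ (a * c1)
          + (Γ₁ a c₀ ρ₀ c1 c2 G2 τ T + Γ₀ a c1 * G1) / ((T : ℝ) + c₀) ^ (a * c1)) ∧
      (∀ K : ℝ, lam ^ 2 = η / (m.rMax + 2 * Rθ) → m.rMax ≤ K →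
        Rθ ≤ K / Real.sqrt (m.eta' μ) → a ≤ K / η →
        a * (G1 + ρ₀ * c2 * G2) / c1
            ≤ M * K ^ 3 * L₁ C b * (Real.log ((T : ℝ) + c₀) - Real.log (ρ₀ * a) + 1)
              / (m.eta' μ * η ^ 3) ∧
        (η ≤ K * m.eta' μ →
          a * (G1 + ρ₀ * c2 * G2) / c1
            ≤ M * K ^ 4 * L₁ C b * (Real.log ((T : ℝ) + c₀) - Real.log (ρ₀ * a) + 1)
              / η ^ 4)) := by
  refine ⟨15576, by norm_num, fun a ρ₀ ξ C b ha hρ hρ1 hξ hξ1 hC hb0 hb1 => ?_⟩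
  obtain ⟨cbar, hcbar⟩ := exists_isThreshold (a := a) (ρ₀ := ρ₀) (C := C) (b := b) hξ
  refine ⟨cbar, two_pos.trans_le hcbar.two_le, ?_⟩
  rintro S A _ _ _ d m μ θstar Rw Rθ lam hμ hmix hφ hfix hRw hRθ hstar hlam c₀ hc₀ Ω _ ℙ _ s hs
    w₀ θ₀ hw₀ hθ₀ τ T hτ hτT η c1 c2 G1 G2 err rfl rfl rfl rfl rfl rfl
  have hth := hcbar.mono hc₀
  have hrec := (hth.isRun ha hρ hρ1 hξ.le hφ hRw hw₀ hθ₀).errorRecursion hth ha hρ hρ1 hξ hξ1 hC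
    hb0 hb1 hμ hmix hfix hstar hlam hs hτ
  have hr := m.rMax_nonneg
  have hF : 0 < m.rMax + 2 * Rθ := by linarith
  have hG1 := hth.G₁_nonneg ha hρ.le m.rMax Rθ T
  have hG2 := hth.four_le_G₂ ha hρ hρ1 T
  refine ⟨fun hξlt hlam_lt hmax => ?_, ?_, fun K hlam_eq hrK hRθK haK => ?_⟩
  · exact hrec.le_of_lt_one hth ha hρ hρ1 hξ.le hξlt hτT ((c₁_pos_iff hF).2 hlam_lt)
      ((c₁_le hF.le).trans (Model.eta_le_three hφ hμ)) (c₂_nonneg hF.le) hG1 hG2 hmax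
  · rintro rfl haη hlam_le hlam_gt
    exact (hrec.mono (sub_le_self _ zero_le_four)).le_of_one ha hth.two_le hρ
      (hth.two_mul_le hρ1 ha.le) hτT ((c₁_nonneg_iff hF).2 hlam_le)
      ((c₁_lt_two_mul_iff hF).2 hlam_gt)
      ((mul_le_mul_of_nonneg_left (c₁_le hF.le) ha.le).trans_lt haη) (c₂_nonneg hF.le) hG1
      (zero_le_four.trans hG2)
  · have hη : 0 < m.eta μ := (div_pos_iff_of_pos_right hF).1 (hlam_eq ▸ pow_pos hlam 2)
    have hη' : 0 < m.eta' μ := pos_of_le_div_sqrt hRθ hRθK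
    have hℓ := zero_le_one.trans (hth.one_le_mixingBound ha hρ hρ1 T)
    have hcoeff := leadingCoeff_le hη' (Model.eta'_le_one hφ hμ) hr hRθ.le hrK hRθK hρ.le hρ1 hη
      (Model.eta_le_three hφ hμ) haK hF hlam_eq hG1 (zero_le_four.trans hG2)
      (hth.G₁_le ha hρ hρ1 _ _ T) (hth.G₂_le ha hρ hρ1 T)
    rw [mul_assoc (15576 * K ^ 3), mul_assoc (15576 * K ^ 4)]
    exact ⟨hcoeff, fun hηK => hcoeff.trans <|
      mul_pow_three_div_le_mul_pow_four_div (by norm_num) (hr.trans hrK) hη hη' hℓ hηK⟩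

theorem theoremt :
    ∃ M : ℝ, 0 < M ∧
    ∀ (a ρ₀ ξ C b : ℝ), 0 < a → 0 < ρ₀ → ρ₀ ≤ 1 → 0 < ξ → ξ ≤ 1 → 1 < C → 0 ≤ b → b < 1 →
    ∃ cbar : ℝ, 0 < cbar ∧
    ∀ (S A : Type*) [Fintype S] [DecidableEq S] [Fintype A] (d : ℕ) (m : Model S A d)
      (μ : S → ℝ) (θstar : EuclideanSpace ℝ (Fin d)) (Rw Rθ lam : ℝ),
      m.P.IsIrreducible → IsAperiodic m.P → IsStationaryDist m.P μ →
      (∀ (k : ℕ) (s : S), mixDist m.P μ k s ≤ C * b ^ k) →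
      m.GoodFeatures → m.IsFixedPoint μ θstar →
      1 ≤ Rw → 0 < Rθ → ‖θstar‖ ≤ Rθ → 0 < lam →
    ∀ (c₀ : ℝ), cbar ≤ c₀ →
    ∀ (Ω : Type*) [MeasurableSpace Ω] (ℙ : Measure Ω) [IsProbabilityMeasure ℙ]
      (s : ℕ → Ω → S), IsMarkovChain m.P ℙ s →
    ∀ (w₀ θ₀ : EuclideanSpace ℝ (Fin d)), ‖w₀‖ ≤ 1 → ‖θ₀‖ ≤ Rθ →
    ∀ (τ T : ℕ), mixingTime m.P μ (ρ₀ * step a c₀ ξ T) ≤ τ → τ ≤ T →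
    ∀ (η c1 c2 G1 G2 err : ℝ), η = m.eta μ →
      c1 = c₁ η m.rMax Rθ lam → c2 = c₂ m.rMax Rθ lam →
      G1 = G₁ a c₀ ρ₀ C b m.rMax Rθ T → G2 = G₂ a c₀ ρ₀ C b T →
      err = ∫ ω, ‖(m.iterates (step a c₀ ξ) (fun t => ρ₀ * step a c₀ ξ t) Rw Rθ
        w₀ θ₀ (fun t => s t ω) T).2 - θstar‖ ^ 2 ∂ℙ →
      -- the case `0 < ξ < 1`
      (ξ < 1 → lam ^ 2 < 2 * η / (m.rMax + 2 * Rθ) →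
        max ((ξ / (a * c1)) ^ (1 / (1 - ξ))) ((ξ / (ρ₀ * a)) ^ (1 / (1 - ξ))) ≤ c₀ →
        err ≤ 4 * Rθ ^ 2 * Real.exp (-(a * c1 / (1 - ξ)) * Δ c₀ ξ τ T)
          + a * (G1 + ρ₀ * c2 * G2) / (c1 * ((T : ℝ) + c₀) ^ ξ)
          + 4 * a * c2 / (1 - ξ) * Real.exp (a * c1 / c₀ ^ ξ) * Δ c₀ ξ τ T
              * Real.exp (-(a / (1 - ξ)) * min c1 (2 * ρ₀) * Δ c₀ ξ τ T)) ∧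
      -- the case `ξ = 1`
      (ξ = 1 → a * η < 1 → lam ^ 2 ≤ 2 * η / (m.rMax + 2 * Rθ) →
        (2 * η - 4 * ρ₀) / (m.rMax + 2 * Rθ) < lam ^ 2 →
        err ≤ 4 * Rθ ^ 2 * (((τ : ℝ) + c₀) / ((T : ℝ) + c₀)) ^ (a * c1)
          + (Γ₁ a c₀ ρ₀ c1 c2 G2 τ T + Γ₀ a c1 * G1) / ((T : ℝ) + c₀) ^ (a * c1)) ∧
      -- dependence of the coefficient of `(T + c₀)^(-ξ)` on the condition numbers
      (∀ K : ℝ, 1 ≤ K → lam ^ 2 = η / (m.rMax + 2 * Rθ) → m.rMax ≤ K →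
        Rθ ≤ K / Real.sqrt (m.eta' μ) → a ≤ K / η →
        a * (G1 + ρ₀ * c2 * G2) / c1
            ≤ M * K ^ 3 * L₁ C b * (Real.log ((T : ℝ) + c₀) - Real.log (ρ₀ * a) + 1)
              / (m.eta' μ * η ^ 3) ∧
        (η ≤ K * m.eta' μ →
          a * (G1 + ρ₀ * c2 * G2) / c1
            ≤ M * K ^ 4 * L₁ C b * (Real.log ((T : ℝ) + c₀) - Real.log (ρ₀ * a) + 1)
              / η ^ 4)) := by
  obtain ⟨M, hM, hgen⟩ := theoremt_general
  refine ⟨M, hM, fun a ρ₀ ξ C b ha hρ hρ1 hξ hξ1 hC hb0 hb1 => ?_⟩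
  refine (hgen a ρ₀ ξ C b ha hρ hρ1 hξ hξ1 hC.le hb0 hb1).imp fun _ h => h.imp_right ?_
  intro h S A _ _ _ d m μ θstar Rw Rθ lam _ _ hμ hmix hfeat hfix hRw hRθ hstar hlam c₀ hc₀ Ω _ ℙ _
    s hs w₀ θ₀ hw₀ hθ₀ τ T hτ hτT η c1 c2 G1 G2 err hη hc1 hc2 hG1 hG2 herr
  exact (h S A d m μ θstar Rw Rθ lam hμ hmix hfeat.norm_le_one hfix hRw hRθ hstar hlam c₀ hc₀ Ω ℙ s
    hs w₀ θ₀ hw₀ hθ₀ τ T hτ hτT η c1 c2 G1 G2 err hη hc1 hc2 hG1 hG2 herr).imp_right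
    (And.imp_right fun hcoeff K _ => hcoeff K)
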